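/- Let $k$ be an infinite field, $n, a\ge 0$ integers, $X\hookrightarrow\mathbb{P}^n_k$ a (locally closed) subscheme and $Z\hookrightarrow X$ a (locally closed) subscheme of $X$. Let $\overline{Z}$ be the scheme-theoretic closure of $Z$ in $\mathbb{P}^n_k$, with ideal sheaf $\mathcal{I}_{\overline{Z}}\subset\mathcal{O}_{\mathbb{P}^n_k}$. Recall that a scheme $Y$ is an $R_a$-scheme if $\mathcal{O}_{Y,y}$ is a regular local ring for every $y\in Y$ with $\dim\mathcal{O}_{Y,y}\le a$, and that $\operatorname{codim}_X(Z)=\inf_{z\in Z}\dim\mathcal{O}_{X,z}$ ($=\infty$ if $Z=\emptyset$). Assume that $X$ is an $R_a$-scheme and that $\operatorname{codim}_X(Z)>a+1$. Then a general hypersurface $H\hookrightarrow\mathbb{P}^n_k$ containing $\overline{Z}$ satisfies that $X\cap H$ is an $R_a$-scheme. That is, there is an integer $d_0$ such that for every $d\ge d_0$ there is a nonempty open subscheme $\mathcal{U}$ of the projective space $|H^0(\mathbb{P}^n_k,\mathcal{I}_{\overline{Z}}(d))|$ of lines in $H^0(\mathbb{P}^n_k,\mathcal{I}_{\overline{Z}}(d))$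 such that for every $H\in\mathcal{U}(k)$, regarded as a hypersurface of degree $d$ in $\mathbb{P}^n_k$ containing $\overline{Z}$, the scheme-theoretic intersection $X\cap H = X\times_{\mathbb{P}^n_k}H$ is an $R_a$-scheme. -/

import Mathlib

open AlgebraicGeometry CategoryTheory CategoryTheory.Limits

universe u

attribute [local instance] MvPolynomial.gradedAlgebra

noncomputable section

namespace RaBertini

/-- The projective space `Proj k[x_i : i ∈ ι]` with homogeneous coordinates indexed by `ι`. -/
abbrev ProjSpace (ι : Type) (k : Type u) [Field k] : Scheme.{u} :=
  Proj (MvPolynomial.homogeneousSubmodule ι k)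

/-- The projective space `ℙⁿ_k = Proj k[x_0, …, x_n]`. -/
abbrev PP (n : ℕ) (k : Type u) [Field k] : Scheme.{u} :=
  ProjSpace (Fin (n + 1)) k

/-- The `k`-rational point `[c]` of projective space with homogeneous coordinates `c ≠ 0`: the
homogeneous prime ideal generated by the homogeneous polynomials that vanish at `c`. -/
def rationalPoint {ι : Type} {k : Type u} [Field k] (c : ι → k) (hc : c ≠ 0) :
    ProjSpace ι k where
  asHomogeneousIdeal := Ideal.homogeneousCore (MvPolynomial.homogeneousSubmodule ι k)
    (RingHom.ker (MvPolynomial.eval c))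
  isPrime := Ideal.IsPrime.homogeneousCore (RingHom.ker_isPrime _)
  not_irrelevant_le := by
    intro h
    obtain ⟨i, hi⟩ := Function.ne_iff.mp hc
    have hX : MvPolynomial.X i ∈ MvPolynomial.homogeneousSubmodule ι k 1 :=
      MvPolynomial.isHomogeneous_X k i
    have h1 : (MvPolynomial.X i : MvPolynomial ι k) ∈
        HomogeneousIdeal.irrelevant (MvPolynomial.homogeneousSubmodule ι k) := by
      rw [HomogeneousIdeal.mem_irrelevant_iff, GradedRing.proj_apply,
        DirectSum.decompose_of_mem_ne _ hX one_ne_zero]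
    have h2 := Ideal.toIdeal_homogeneousCore_le _ _ (h h1)
    rw [RingHom.mem_ker, MvPolynomial.eval_X] at h2
    exact hi h2

/-- A homogeneous polynomial vanishes at the point `[c]` exactly when it vanishes at `c`. -/
lemma mem_rationalPoint_iff {ι : Type} {k : Type u} [Field k] (c : ι → k) (hc : c ≠ 0)
    (d : ℕ) (F : MvPolynomial ι k) (hF : F.IsHomogeneous d) :
    F ∈ (rationalPoint c hc).asHomogeneousIdeal ↔ MvPolynomial.eval c F = 0 := by
  constructor
  · intro h
    exact Ideal.toIdeal_homogeneousCore_le _ _ h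
  · intro h
    exact Ideal.mem_homogeneousCore_of_homogeneous_of_mem ⟨d, hF⟩ h

section Sections

variable {k : Type u} [Field k] {n : ℕ}

/-- The standard chart `D₊(x_i)` of `ℙⁿ`, as an affine open. -/
def chart (k : Type u) [Field k] {n : ℕ} (i : Fin (n + 1)) : (PP n k).affineOpens :=
  ⟨Proj.basicOpen _ (MvPolynomial.X i : MvPolynomial (Fin (n + 1)) k),
    Proj.isAffineOpen_basicOpen _ _ (m := 1) (MvPolynomial.isHomogeneous_X k i) one_pos⟩

/-- The fraction `s / x_i ^ d` in the degree-zero part of `k[x]_{x_i}`, for `s` of degree `d`. -/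
def dehomAway {d : ℕ} (s : MvPolynomial.homogeneousSubmodule (Fin (n + 1)) k d)
    (i : Fin (n + 1)) :
    HomogeneousLocalization.Away (MvPolynomial.homogeneousSubmodule (Fin (n + 1)) k)
      (MvPolynomial.X i) :=
  HomogeneousLocalization.Away.mk _ (d := 1) (MvPolynomial.isHomogeneous_X k i) d s.1
    (by rw [smul_eq_mul, mul_one]; exact s.2)

/-- The regular function `s / x_i ^ d` on `D₊(x_i)`: the section `s` of `𝒪(d)` in the
trivialization of `𝒪(d)` on `D₊(x_i)` by `x_i ^ d`. -/
def dehom {d : ℕ} (s : MvPolynomial.homogeneousSubmodule (Fin (n + 1)) k d)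
    (i : Fin (n + 1)) : Γ(PP n k, (chart k i).1) :=
  (Proj.awayToSection _ _).hom (dehomAway s i)

lemma val_dehomAway {d : ℕ} (s : MvPolynomial.homogeneousSubmodule (Fin (n + 1)) k d)
    (i : Fin (n + 1)) :
    (dehomAway s i).val = Localization.mk s.1
      (⟨MvPolynomial.X i ^ d, ⟨d, rfl⟩⟩ : Submonoid.powers (MvPolynomial.X i)) := rfl

lemma dehom_zero {d : ℕ} (i : Fin (n + 1)) :
    dehom (0 : MvPolynomial.homogeneousSubmodule (Fin (n + 1)) k d) i = 0 := by
  have : dehomAway (0 : MvPolynomial.homogeneousSubmodule (Fin (n + 1)) k d) i = 0 := by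
    apply HomogeneousLocalization.val_injective
    rw [val_dehomAway, HomogeneousLocalization.val_zero]
    exact Localization.mk_zero _
  rw [dehom, this, map_zero]
  rfl

lemma dehom_add {d : ℕ} (s t : MvPolynomial.homogeneousSubmodule (Fin (n + 1)) k d)
    (i : Fin (n + 1)) : dehom (s + t) i = dehom s i + dehom t i := by
  have : dehomAway (s + t) i = dehomAway s i + dehomAway t i := by
    apply HomogeneousLocalization.val_injective
    rw [HomogeneousLocalization.val_add, val_dehomAway, val_dehomAway, val_dehomAway,
      Localization.add_mk_self]
    rfl
  rw [dehom, this, map_add]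
  rfl

lemma dehom_smul {d : ℕ} (c : k) (s : MvPolynomial.homogeneousSubmodule (Fin (n + 1)) k d)
    (i : Fin (n + 1)) : ∃ r, dehom (c • s) i = r * dehom s i := by
  let c' : MvPolynomial.homogeneousSubmodule (Fin (n + 1)) k 0 :=
    ⟨MvPolynomial.C c, MvPolynomial.isHomogeneous_C _ c⟩
  have : dehomAway (c • s) i = dehomAway c' i * dehomAway s i := by
    apply HomogeneousLocalization.val_injective
    rw [HomogeneousLocalization.val_mul, val_dehomAway, val_dehomAway, val_dehomAway,
      Localization.mk_mul]
    congr 1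
    · simp [c', MvPolynomial.smul_eq_C_mul]
    · ext
      simp
  exact ⟨dehom c' i, by rw [dehom, this, map_mul]; rfl⟩

/-- `H⁰(ℙⁿ, I(d))` for an ideal sheaf `I` on `ℙⁿ`, as a subspace of
`H⁰(ℙⁿ, 𝒪(d)) = k[x_0, …, x_n]_d`: the forms `s` of degree `d` for which every
`s / x_i ^ d` lies in `I(D₊(x_i))`. -/
def globalSections (I : (PP n k).IdealSheafData) (d : ℕ) :
    Submodule k (MvPolynomial.homogeneousSubmodule (Fin (n + 1)) k d) where
  carrier := {s | ∀ i, dehom s i ∈ I.ideal (chart k i)}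
  zero_mem' i := by rw [dehom_zero]; exact zero_mem _
  add_mem' hs ht i := by rw [dehom_add]; exact add_mem (hs i) (ht i)
  smul_mem' c s hs i := by
    obtain ⟨r, hr⟩ := dehom_smul c s i
    rw [hr]
    exact Ideal.mul_mem_left _ _ (hs i)

instance (I : (PP n k).IdealSheafData) (d : ℕ) : Module.Finite k (globalSections I d) :=
  have : Module.Finite k (MvPolynomial.homogeneousSubmodule (Fin (n + 1)) k d) :=
    Module.Finite.iff_fg.mpr (MvPolynomial.homogeneousSubmodule_fg _ k d)
  inferInstance

instance (I : (PP n k).IdealSheafData) (d : ℕ) : Module.Free k (globalSections I d) :=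
  Module.Free.of_divisionRing k (globalSections I d)

/-- The ideal sheaf of the hypersurface `{s = 0}`: the smallest ideal sheaf `J` on `ℙⁿ` such that
`s` is a section of `J(d)`. -/
def hypersurfaceIdeal {d : ℕ} (s : MvPolynomial.homogeneousSubmodule (Fin (n + 1)) k d) :
    (PP n k).IdealSheafData :=
  sInf {J | s ∈ globalSections J d}

/-- The intersection `X ∩ H` of a subscheme `i : X ⟶ ℙⁿ` with the hypersurface `H = {s = 0}`. -/
def interHypersurface {X : Scheme.{u}} (i : X ⟶ PP n k) {d : ℕ}
    (s : MvPolynomial.homogeneousSubmodule (Fin (n + 1)) k d) : Scheme.{u} :=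
  pullback i (hypersurfaceIdeal s).subschemeι

/-- The projective space `|H⁰(ℙⁿ, I(d))|` of lines in `H⁰(ℙⁿ, I(d))`, with the homogeneous
coordinates given by a basis of `H⁰(ℙⁿ, I(d))`. It is empty if there are no nonzero sections. -/
abbrev linearSystem (I : (PP n k).IdealSheafData) (d : ℕ) : Scheme.{u} :=
  ProjSpace (Fin (Module.finrank k (globalSections I d))) k

/-- The `k`-rational point of `|H⁰(ℙⁿ, I(d))|` given by the line through a nonzero section. -/
def linearSystemPoint {I : (PP n k).IdealSheafData} {d : ℕ} (s : globalSections I d)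
    (hs : s ≠ 0) : linearSystem I d :=
  rationalPoint (⇑((Module.finBasis k (globalSections I d)).repr s))
    (by simpa using hs)

/-- A general hypersurface `H ⊆ ℙⁿ` containing the closed subscheme with ideal sheaf `I`
satisfies the property `P` for the subscheme `i : X ⟶ ℙⁿ`: for all `d ≫ 0` there is a nonempty
open `U ⊆ |H⁰(ℙⁿ, I(d))|` such that `X ∩ H` has `P` for every `H ∈ U(k)`. -/
def GeneralHypersurface (I : (PP n k).IdealSheafData) {X : Scheme.{u}} (i : X ⟶ PP n k)
    (P : Scheme.{u} → Prop) : Prop :=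
  ∃ d₀ : ℕ, ∀ d : ℕ, d₀ ≤ d → ∃ U : (linearSystem I d).Opens,
    (U : Set (linearSystem I d)).Nonempty ∧
    ∀ (s : globalSections I d) (hs : s ≠ 0), linearSystemPoint s hs ∈ U →
      P (interHypersurface i s.1)

end Sections

/-- `X` is an `R_a`-scheme: the local ring at every point of codimension at most `a` is regular. -/
def IsRa (a : ℕ) (X : Scheme.{u}) : Prop :=
  ∀ x : X, ringKrullDim (X.presheaf.stalk x) ≤ a → IsRegularLocalRing (X.presheaf.stalk x)

/-- The codimension in `X` of a subscheme `j : Z ⟶ X`, i.e. the infimum over the points `z` of `Z`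
of the codimension of `z` in `X` (the supremum of the lengths of chains of generizations of `z` in
`X`, equal to `dim 𝒪_{X,z}`). It is `⊤` if `Z` is empty. -/
def codim {Z X : Scheme.{u}} (j : Z ⟶ X) : ℕ∞ :=
  ⨅ z : Z, Order.coheight (j z)

end RaBertini

end

/-! By Krull, a point of `X ∩ H` of codimension at most `a` has codimension at most `a + 1` in `X`.
A point of `X` in the closure of `Z` is a specialization of a point of `Z`, so its codimension
exceeds `a + 1` (`lt_coheight_of_mem_support_ker`). Hence only points `x` outside the closure of `Z`
matter. There the local ring of `X ∩ H` is `𝒪_{X,x} / f` with `f` a local equation of `H`, and it is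
regular once `𝒪_{X,x}` is regular and `f ∉ 𝔪²`.

Regularity of `𝒪_{X,x}` is given in codimension at most `a`. On an affine piece it fails at only
finitely many points of codimension `a + 1` (`finite_setOf_not_isRegularLocalRing`), and a general
`H` misses them. This finiteness rests on generic regularity of integral algebras of finite type.
Since `k` may be imperfect, that is proved by a Jacobian criterion with derivations over the prime
field (`exists_notMem_isRegularLocalRing_quotient`).

The condition `f ∉ 𝔪²` comes from a dimension count valid in every characteristic. If `f ∈ 𝔪²` at a
point, then `f` and all its `k`-derivatives vanish there. At a point with residue field `K` this
amounts to `1 + dim_K (K ⊗ Ω)` linear conditions on the section. They are independent when the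
sections separate tangent vectors, and their number exceeds `trdeg K`. So as the point moves in a
dense open part of its closure, the bad sections stay in a proper closed subset
(`exists_map_eq_sum_linearForm_mul`, `exists_general_not_mem_sq_of_prime`). Noetherian induction
does the rest.

Separation holds outside the closure of `Z`: some form `g` vanishing on `Z` is invertible near the
point, and the multiples `g x_m^(d-e-1) x_j` with `e = deg g < d` suffice
(`eq_zero_of_jet_eq_zero`). Finitely many affine pieces cover the relevant points, and the product
of their polynomials yields the open set (`exists_open_of_general`). -/

noncomputable section

namespace RaBertini

/-! ### Field extensions of a perfect field are formally smooth -/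

section FormallySmooth

open Algebra MvPolynomial TensorProduct

variable {F P K : Type*} [CommRing F] [CommRing P] [Algebra F P] [Field K]
    [Algebra F K] [Algebra P K] [IsScalarTower F P K]

lemma one_tmul_D_eq_zero_iff (x : P) :
    (1 : K) ⊗ₜ[P] KaehlerDifferential.D F P x = 0 ↔ ∀ D : Derivation F P K, D x = 0 := by
  constructor
  · intro h D
    have := congrArg (D.liftKaehlerDifferential.liftBaseChange K) h
    simpa using this
  · intro h
    rw [← Module.forall_dual_apply_eq_zero_iff K]
    intro φ
    let ψ : Ω[P⁄F] →ₗ[P] K := (φ.restrictScalars P).comp (TensorProduct.mk P K _ 1)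
    exact h (ψ.compDer (KaehlerDifferential.D F P))

/-- What has to be shown is injectivity of the conormal map of the presentation `F[L] → L`. An
element of the kernel involves finitely many variables, so injectivity can be tested over a finitely
generated subfield `E`, where it is known. -/
lemma formallySmooth_of_perfectField (F L : Type*) [Field F] [Field L] [Algebra F L]
    [PerfectField F] : FormallySmooth F L := by
  let algP (L : Type _) [Field L] [Algebra F L] : Algebra (MvPolynomial L F) L :=
    (aeval (R := F) (id : L → L)).toAlgebra
  have tow (L : Type _) [Field L] [Algebra F L] : IsScalarTower F (MvPolynomial L F) L :=
    .of_algebraMap_eq' (aeval (R := F) (id : L → L)).comp_algebraMap.symm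
  have amX (L : Type _) [Field L] [Algebra F L] (l : L) :
      algebraMap (MvPolynomial L F) L (X l) = l := aeval_X _ _
  have surj (L : Type _) [Field L] [Algebra F L] :
      Function.Surjective (algebraMap (MvPolynomial L F) L) := fun l => ⟨X l, amX L l⟩
  refine ⟨inferInstance, (FormallySmooth.kerCotangentToTensor_injective_iff (surj L)).mp ?_⟩
  rw [injective_iff_map_eq_zero]
  intro y hy
  obtain ⟨⟨x, hx⟩, rfl⟩ := Ideal.toCotangent_surjective _ y
  rw [KaehlerDifferential.kerCotangentToTensor_toCotangent, one_tmul_D_eq_zero_iff] at hy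
  rw [Ideal.toCotangent_eq_zero]
  obtain ⟨s, q, rfl⟩ := exists_finset_rename x
  let E := IntermediateField.adjoin F (s : Set L)
  have : EssFiniteType F E := IntermediateField.essFiniteType_iff.mpr
    ⟨s, rfl⟩
  have hE : FormallySmooth F E := inferInstance
  let j : s → E := fun l => ⟨l.1, IntermediateField.subset_adjoin F _ l.2⟩
  let ι : MvPolynomial E F →ₐ[F] MvPolynomial L F := rename Subtype.val
  have hι (z) : algebraMap _ L (ι z) = (algebraMap (MvPolynomial E F) E z : L) := by
    have : (IsScalarTower.toAlgHom F (MvPolynomial L F) L).comp ι =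
        E.val.comp (IsScalarTower.toAlgHom F (MvPolynomial E F) E) := by
      ext l; simp [ι, amX]
    exact DFunLike.congr_fun this z
  have hxq : rename Subtype.val q = ι (rename j q) := by
    simp only [ι, rename_rename]; rfl
  simp only [hxq] at hx hy ⊢
  have hx' : rename j q ∈ RingHom.ker (algebraMap (MvPolynomial E F) E) := by
    rw [RingHom.mem_ker, hι] at hx
    exact Subtype.ext hx
  have key : (1 : E) ⊗ₜ[MvPolynomial E F] KaehlerDifferential.D F _ (rename j q) = 0 := by
    rw [one_tmul_D_eq_zero_iff]
    intro D
    classical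
    -- Extension of `D` by zero on the variables outside `E`.
    let D' : Derivation F (MvPolynomial L F) L := mkDerivation F
      (fun l => if h : l ∈ E then (D (X ⟨l, h⟩) : L) else 0)
    have hD (z) : D' (ι z) = (D z : L) := by
      induction z using MvPolynomial.induction_on with
      | C a => simp [ι, ← algebraMap_eq]
      | add p q hp hq => simp [hp, hq]
      | mul_X p l hp =>
        rw [map_mul, Derivation.leibniz, Derivation.leibniz, hp]
        simp only [Algebra.smul_def, hι]
        simp [ι, D', mkDerivation_X, amX]
    exact Subtype.ext ((hD _).symm.trans (hy D'))
  have h0 := (injective_iff_map_eq_zero _).mp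
    ((FormallySmooth.kerCotangentToTensor_injective_iff (R := F) (surj E)).mpr inferInstance)
    (Ideal.toCotangent _ ⟨_, hx'⟩)
    (by rw [KaehlerDifferential.kerCotangentToTensor_toCotangent]; exact key)
  rw [Ideal.toCotangent_eq_zero] at h0
  have h1 := Ideal.mem_map_of_mem ι h0
  rw [Ideal.map_pow] at h1
  refine Ideal.pow_right_mono (Ideal.map_le_iff_le_comap.mpr fun z hz => ?_) 2 h1
  rw [Ideal.mem_comap, RingHom.mem_ker, hι, RingHom.mem_ker.mp hz]; rfl

end FormallySmooth

/-! ### Regular quotients, denominators, and derivations on squares -/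

section Regular

open IsLocalRing Algebra

/-- Dividing by `r` independent cotangent vectors lowers the embedding dimension by `r`, while the
Krull dimension drops by at most `r`. -/
lemma isRegularLocalRing_quotient_span {R : Type*} [CommRing R] [IsRegularLocalRing R] {r : ℕ}
    (f : Fin r → R) (hf : ∀ j, f j ∈ maximalIdeal R)
    (hli : LinearIndependent (ResidueField R)
      (fun j => ((maximalIdeal R).toCotangent ⟨f j, hf j⟩ : CotangentSpace R))) :
    IsRegularLocalRing (R ⧸ Ideal.span (Set.range f)) := by
  set v : Fin r → CotangentSpace R := fun j => (maximalIdeal R).toCotangent ⟨f j, hf j⟩ with hv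
  let W := Submodule.span (ResidueField R) (Set.range v)
  have hW : Module.finrank (ResidueField R) W = r := by
    simpa using finrank_span_eq_card hli
  let b := Module.finBasis (ResidueField R) (CotangentSpace R ⧸ W)
  set e := Module.finrank (ResidueField R) (CotangentSpace R ⧸ W) with he
  have hre : e + r = Module.finrank (ResidueField R) (CotangentSpace R) := by
    rw [← W.finrank_quotient_add_finrank, hW]
  have hg (i : Fin e) : ∃ g : maximalIdeal R,
      W.mkQ ((maximalIdeal R).toCotangent g : CotangentSpace R) = b i := by
    obtain ⟨y, hy⟩ := W.mkQ_surjective (b i)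
    obtain ⟨g, rfl⟩ := Ideal.toCotangent_surjective _ y
    exact ⟨g, hy⟩
  choose g hg using hg
  let s : Set (maximalIdeal R) := Set.range (fun j => (⟨f j, hf j⟩ : maximalIdeal R)) ∪ Set.range g
  have hs : Submodule.span R s = ⊤ := by
    rw [← CotangentSpace.span_image_eq_top_iff, _root_.eq_top_iff]
    have hWs : W ≤ Submodule.span (ResidueField R)
        (((maximalIdeal R).toCotangent : _ → CotangentSpace R) '' s) := by
      refine Submodule.span_mono ?_
      rintro _ ⟨j, rfl⟩
      exact ⟨_, Or.inl ⟨j, rfl⟩, rfl⟩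
    rintro x -
    have hx : W.mkQ x ∈ Submodule.map W.mkQ (Submodule.span (ResidueField R)
        (((maximalIdeal R).toCotangent : _ → CotangentSpace R) '' s)) := by
      have hb : (⊤ : Submodule (ResidueField R) (CotangentSpace R ⧸ W)) ≤ Submodule.map W.mkQ
          (Submodule.span (ResidueField R)
            (((maximalIdeal R).toCotangent : _ → CotangentSpace R) '' s)) := by
        rw [← b.span_eq, Submodule.span_le]
        rintro _ ⟨i, rfl⟩
        exact ⟨_, Submodule.subset_span ⟨g i, Or.inr ⟨i, rfl⟩, rfl⟩, hg i⟩
      exact hb trivial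
    obtain ⟨y, hy, hxy⟩ := hx
    have hW' : x - y ∈ W := by
      rw [← Submodule.ker_mkQ W, LinearMap.mem_ker, map_sub, hxy, sub_self]
    have := add_mem (hWs hW') hy
    rwa [sub_add_cancel] at this
  have hle : Ideal.span (Set.range f) ≤ maximalIdeal R := by
    rw [Ideal.span_le]; rintro _ ⟨j, rfl⟩; exact hf j
  have : Nontrivial (R ⧸ Ideal.span (Set.range f)) :=
    Ideal.Quotient.nontrivial_iff.mpr (ne_top_of_le_ne_top (Ideal.IsPrime.ne_top') hle)
  have hloc : IsLocalRing (R ⧸ Ideal.span (Set.range f)) :=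
    .of_surjective' (Ideal.Quotient.mk _) Ideal.Quotient.mk_surjective
  refine IsRegularLocalRing.of_spanFinrank_maximalIdeal_le _ ?_
  have hmax : maximalIdeal (R ⧸ Ideal.span (Set.range f)) =
      Ideal.span (Set.range fun i => Ideal.Quotient.mk _ (g i : R)) := by
    have : maximalIdeal (R ⧸ Ideal.span (Set.range f)) =
      (maximalIdeal R).map (Ideal.Quotient.mk _) := by
      have hc := Ideal.comap_isMaximal_of_surjective (Ideal.Quotient.mk (Ideal.span (Set.range f)))
        Ideal.Quotient.mk_surjective (K := maximalIdeal _)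
      rw [← IsLocalRing.eq_maximalIdeal hc,
        Ideal.map_comap_of_surjective _ Ideal.Quotient.mk_surjective]
    rw [this]
    have hm : maximalIdeal R = Ideal.span (Set.range f ∪ Set.range fun i => (g i : R)) := by
      have := congrArg (Submodule.map (maximalIdeal R).subtype) hs
      rw [Submodule.map_span, Submodule.map_top, Submodule.range_subtype] at this
      rw [Set.image_union, ← Set.range_comp, ← Set.range_comp] at this
      exact this.symm
    conv_lhs => rw [hm]
    rw [Ideal.map_span, Set.image_union, Ideal.span_union, ← Set.range_comp, ← Set.range_comp]
    refine sup_eq_right.mpr ?_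
    rw [Ideal.span_le]
    rintro _ ⟨j, rfl⟩
    have : Ideal.Quotient.mk (Ideal.span (Set.range f)) (f j) = 0 :=
      Ideal.Quotient.eq_zero_iff_mem.mpr (Ideal.subset_span ⟨j, rfl⟩)
    simp [this]
  have h1 : (maximalIdeal (R ⧸ Ideal.span (Set.range f))).spanFinrank ≤ e := by
    rw [hmax]
    refine (Submodule.spanFinrank_span_le_ncard_of_finite (Set.finite_range _)).trans ?_
    exact (Set.image_univ (f := fun i => Ideal.Quotient.mk (Ideal.span (Set.range f)) (g i : R))) ▸
      (Set.ncard_image_le Set.finite_univ).trans (by rw [Set.ncard_univ, Nat.card_fin])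
  have h2 := ringKrullDim_le_ringKrullDim_quotient_add_encard (Set.range f)
    (by rw [IsLocalRing.ringJacobson_eq_maximalIdeal]; exact Ideal.span_le.mp hle)
  rw [← (IsRegularLocalRing.iff_finrank_cotangentSpace R).mp inferInstance, ← hre] at h2
  have h3 : (Set.range f).encard ≤ r := by
    rw [← Set.image_univ]
    exact (Set.encard_image_le _ _).trans (by simp [Set.encard_univ])
  refine (Nat.cast_le.mpr h1).trans ?_
  have h4 : ((e : WithBot ℕ∞) + r) ≤ ringKrullDim (R ⧸ Ideal.span (Set.range f)) + r := by
    refine le_trans (by exact_mod_cast h2) ?_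
    gcongr
    exact_mod_cast h3
  exact ENat.WithBot.add_le_add_natCast_right_iff.mp h4

/-- `M` need not be finitely generated: the case in view is `Ω` of a polynomial ring over the prime
field. Denominators of `l` are cleared only on the finitely many elements through which a projective
splitting expresses the `v j`. -/
lemma exists_linearMap_quotient_of_projective {P M K : Type*} [CommRing P] (I : Ideal P)
    [I.IsPrime] [Field K] [Algebra P K] [Algebra (P ⧸ I) K] [IsScalarTower P (P ⧸ I) K]
    [IsFractionRing (P ⧸ I) K] [AddCommGroup M] [Module P M] [Module.Projective P M]
    (l : M →ₗ[P] K) {ι : Type*} [Finite ι] (v : ι → M) :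
    ∃ c ∉ I, ∃ l' : M →ₗ[P] P ⧸ I, ∀ j, algebraMap (P ⧸ I) K (l' (v j)) = c • l (v j) := by
  classical
  obtain ⟨s, hs⟩ := Module.projective_def'.mp ‹Module.Projective P M›
  cases nonempty_fintype ι
  let T : Finset M := Finset.univ.biUnion fun j => (s (v j)).support
  obtain ⟨⟨c, hc⟩, hcT⟩ := IsLocalization.exist_integer_multiples (nonZeroDivisors (P ⧸ I)) T
    (fun m => l m)
  obtain ⟨c, rfl⟩ := Ideal.Quotient.mk_surjective c
  have hcI : c ∉ I := by
    intro h
    rw [Ideal.Quotient.eq_zero_iff_mem.mpr h] at hc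
    exact zero_notMem_nonZeroDivisors hc
  -- The value `0` outside `T` is harmless: only elements of the supports of the `s (v j)` enter.
  let w : M → P ⧸ I := fun m => if h : m ∈ T then (hcT m h).choose else 0
  have hw (m) (h : m ∈ T) : algebraMap (P ⧸ I) K (w m) = c • l m := by
    simp only [w, dif_pos h]
    rw [(hcT m h).choose_spec]
    simp [Algebra.smul_def, IsScalarTower.algebraMap_apply P (P ⧸ I) K]
  refine ⟨c, hcI, (Finsupp.linearCombination P w).comp s, fun j => ?_⟩
  have h1 : v j = Finsupp.linearCombination P id (s (v j)) := (LinearMap.congr_fun hs (v j)).symm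
  conv_rhs => rw [h1]
  rw [LinearMap.comp_apply, Finsupp.linearCombination_apply, Finsupp.linearCombination_apply,
    Finsupp.sum, Finsupp.sum, map_sum, map_sum, Finset.smul_sum]
  refine Finset.sum_congr rfl fun m hm => ?_
  have hmT : m ∈ T := Finset.mem_biUnion.mpr ⟨j, Finset.mem_univ _, hm⟩
  rw [LinearMap.map_smul, smul_comm c, id_eq, ← hw m hmT, Algebra.smul_def, Algebra.smul_def, map_mul,
    ← IsScalarTower.algebraMap_apply]

/-- By Leibniz, `D` kills `Q ^ 2` and `D (m * x) = m • D x`, with values in the domain `P ⧸ Q`. -/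
lemma derivation_eq_zero_of_mul_mem_sq {F P : Type*} [CommRing F] [CommRing P] [Algebra F P]
    (Q : Ideal P) [Q.IsPrime] (D : Derivation F P (P ⧸ Q)) {m x : P} (hm : m ∉ Q)
    (h : m * x ∈ Q ^ 2) : D x = 0 := by
  have hQ {y z} (hy : y ∈ Q) : y • (z : P ⧸ Q) = 0 := by
    rw [Algebra.smul_def, Ideal.Quotient.algebraMap_eq, Ideal.Quotient.eq_zero_iff_mem.mpr hy,
      zero_mul]
  have hD {y} (hy : y ∈ Q ^ 2) : D y = 0 := by
    rw [sq] at hy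
    refine Submodule.mul_induction_on hy (fun a ha b hb => ?_) fun a b ha hb => ?_
    · rw [Derivation.leibniz, hQ ha, hQ hb, add_zero]
    · rw [map_add, ha, hb, add_zero]
  have hx : x ∈ Q :=
    (Ideal.IsPrime.mem_or_mem ‹_› (Ideal.pow_le_self two_ne_zero h)).resolve_left hm
  have := hD h
  rw [Derivation.leibniz, hQ hx, add_zero, Algebra.smul_def, mul_eq_zero] at this
  exact this.resolve_left fun h => hm (Ideal.Quotient.eq_zero_iff_mem.mp h)

lemma algebraMap_mem_maximalIdeal_sq_iff {P S : Type*} [CommRing P]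
    (Q : Ideal P) [Q.IsPrime] [CommRing S] [Algebra P S] [IsLocalization.AtPrime S Q]
    [IsLocalRing S] {x : P} :
    algebraMap P S x ∈ maximalIdeal S ^ 2 ↔ ∃ m ∉ Q, m * x ∈ Q ^ 2 := by
  rw [← IsLocalization.AtPrime.map_eq_maximalIdeal Q S, ← Ideal.map_pow,
    IsLocalization.algebraMap_mem_map_algebraMap_iff Q.primeCompl]
  rfl

lemma exists_mul_mem_of_map_le {P S : Type*} [CommRing P] [CommRing S] [Algebra P S]
    (M : Submonoid P) [IsLocalization M S] (I J : Ideal P) (hI : I.FG)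
    (h : I.map (algebraMap P S) ≤ J.map (algebraMap P S)) :
    ∃ m ∈ M, ∀ x ∈ I, m * x ∈ J := by
  obtain ⟨s, rfl⟩ := hI
  have (x : s) : ∃ m ∈ M, m * x.1 ∈ J :=
    (IsLocalization.algebraMap_mem_map_algebraMap_iff M S J x.1).mp
      (h (Ideal.mem_map_of_mem _ (Ideal.subset_span x.2)))
  choose m hm hx using this
  refine ⟨∏ x, m x, prod_mem fun x _ => hm x, fun x hx' => ?_⟩
  refine Submodule.span_induction (fun y hy => ?_) (by simp) (fun a b _ _ ha hb => ?_)
    (fun a b _ hb => ?_) hx'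
  · exact Ideal.mem_of_dvd _ (mul_dvd_mul_right (Finset.dvd_prod_of_mem m (Finset.mem_univ ⟨y, hy⟩)) _)
      (hx ⟨y, hy⟩)
  · rw [mul_add]; exact add_mem ha hb
  · rw [smul_eq_mul, mul_left_comm]; exact J.mul_mem_left _ hb

end Regular

/-! ### Jacobian criterion over a perfect field -/

section GenericRegularity

open IsLocalRing Algebra

/-- Formal smoothness of `K` over `F` gives a coefficient field `σ : K → R/𝔪²`. Then `x ↦ σ(x̄) - x`
is a derivation `R → 𝔪/𝔪²` that restricts on `𝔪` to minus the class map. Its coordinates in a basis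
of `𝔪/𝔪²` are dual, up to units, to generators of `𝔪`. -/
lemma exists_derivations_residueField (F : Type*) {P : Type*} [Field F] [PerfectField F] [CommRing P]
    [Algebra F P] [IsNoetherianRing P] (I : Ideal P) [I.IsPrime] :
    ∃ (r : ℕ) (f : Fin r → P) (D : Fin r → Derivation F P I.ResidueField),
      (∀ j, f j ∈ I) ∧ (∀ i j, D i (f j) = 0 ↔ i ≠ j) ∧
      I.map (algebraMap P (Localization.AtPrime I)) =
        (Ideal.span (Set.range f)).map (algebraMap P (Localization.AtPrime I)) := by
  let R := Localization.AtPrime I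
  let K := ResidueField R
  have : FormallySmooth F K := formallySmooth_of_perfectField F K
  let B := R ⧸ maximalIdeal R ^ 2
  let N : Ideal B := (maximalIdeal R).cotangentIdeal
  let π : B →ₐ[F] K := Ideal.Quotient.liftₐ _ (IsScalarTower.toAlgHom F R K) (by
    intro a ha
    exact (residue_eq_zero_iff a).mpr (Ideal.pow_le_self two_ne_zero ha))
  have hπ (x : R) : π (Ideal.Quotient.mk _ x) = residue R x := rfl
  have hker : RingHom.ker π = N := by
    ext x
    obtain ⟨x, rfl⟩ := Ideal.Quotient.mk_surjective x
    rw [RingHom.mem_ker, hπ, residue_eq_zero_iff, Ideal.mk_mem_cotangentIdeal]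
  obtain ⟨σ, hσ⟩ : ∃ σ : K →ₐ[F] B, ∀ x, π (σ x) = x := by
    refine ⟨FormallySmooth.liftOfSurjective (AlgHom.id F K) π ?_ ⟨2, ?_⟩, fun x =>
      FormallySmooth.liftOfSurjective_apply _ _ _ _ x⟩
    · intro x
      obtain ⟨x, rfl⟩ := residue_surjective x
      exact ⟨_, hπ x⟩
    · exact hker ▸ (maximalIdeal R).cotangentIdeal_square
  let δ₀ : Derivation F R N := derivationToSquareZeroOfLift N
    (maximalIdeal R).cotangentIdeal_square (σ.comp (IsScalarTower.toAlgHom F R K)) (by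
      refine AlgHom.ext fun x => Ideal.Quotient.eq.mpr ?_
      change σ (residue R x) - Ideal.Quotient.mk _ x ∈ N
      rw [← hker, RingHom.mem_ker, map_sub, hσ, hπ, sub_self])
  let δ : Derivation F R (CotangentSpace R) :=
    ((maximalIdeal R).cotangentEquivIdeal.symm : N →ₗ[R] CotangentSpace R).compDer δ₀
  have hδ (x : R) (hx : x ∈ maximalIdeal R) : δ x = - (maximalIdeal R).toCotangent ⟨x, hx⟩ := by
    change (maximalIdeal R).cotangentEquivIdeal.symm (δ₀ x) = _
    rw [LinearEquiv.symm_apply_eq, map_neg]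
    ext
    rw [derivationToSquareZeroOfLift_apply]
    change σ (residue R x) - _ = _
    rw [(residue_eq_zero_iff x).mpr hx, map_zero, zero_sub]
    rfl
  let b := Module.finBasis K (CotangentSpace R)
  have hg (i) : ∃ g : maximalIdeal R, (maximalIdeal R).toCotangent g = b i :=
    Ideal.toCotangent_surjective _ (b i)
  choose g hg using hg
  have hf (i) : ∃ (f : P) (t : I.primeCompl), (g i : R) * algebraMap P R t = algebraMap P R f := by
    obtain ⟨⟨f, t⟩, h⟩ := IsLocalization.surj I.primeCompl (g i : R)
    exact ⟨f, t, h⟩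
  choose f t hft using hf
  have ht (i) : residue R (algebraMap P R (t i)) ≠ 0 := by
    rw [Ne, residue_eq_zero_iff]
    exact fun h => (mem_maximalIdeal _).mp h (IsLocalization.map_units R (t i))
  have hfm (i) : algebraMap P R (f i) ∈ maximalIdeal R := by
    rw [← hft]; exact Ideal.mul_mem_right _ _ (g i).2
  let D (i) : Derivation F P K := Derivation.compAlgebraMap P
    (((b.coord i).restrictScalars R).compDer δ)
  refine ⟨_, f, D, fun j => ?_, fun i j => ?_, ?_⟩
  · exact (IsLocalization.AtPrime.to_map_mem_maximal_iff R I (f j)).mp (hfm j)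
  · have : D i (f j) = - (residue R (algebraMap P R (t j)) * b.coord i (b j)) := by
      change b.coord i (δ (algebraMap P R (f j))) = _
      have h1 : (⟨algebraMap P R (f j), hfm j⟩ : maximalIdeal R) =
          algebraMap P R (t j) • g j := Subtype.ext ((hft j).symm.trans (mul_comm _ _))
      rw [hδ _ (hfm j), map_neg, h1, LinearMap.map_smul, hg, ← smul_eq_mul, ← LinearMap.map_smul]
      rfl
    rw [this, neg_eq_zero, mul_eq_zero, or_iff_right (ht j), Module.Basis.coord_apply,
      Module.Basis.repr_self]
    by_cases h : i = j
    · simp [h]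
    · simp [h]
  · rw [Localization.AtPrime.map_eq_maximalIdeal]
    refine le_antisymm ?_ ?_
    · have hs : Submodule.span R (Set.range g) = ⊤ := by
        rw [← CotangentSpace.span_image_eq_top_iff, ← Set.range_comp, ← b.span_eq]
        congr 2
        exact funext hg
      have := congrArg (Submodule.map (maximalIdeal R).subtype) hs
      rw [Submodule.map_span, Submodule.map_top, Submodule.range_subtype, ← Set.range_comp] at this
      refine this.symm.le.trans (Submodule.span_le.mpr ?_)
      rintro _ ⟨i, rfl⟩
      have := Ideal.mem_map_of_mem (algebraMap P R) (Ideal.subset_span (Set.mem_range_self i) :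
        f i ∈ Ideal.span (Set.range f))
      rw [← hft] at this
      exact (Ideal.mul_unit_mem_iff_mem _ (IsLocalization.map_units R (t i))).mp this
    · rw [Ideal.map_span, Ideal.span_le]
      rintro _ ⟨_, ⟨i, rfl⟩, rfl⟩
      exact hfm i

/-- After clearing denominators, the derivations dual to local generators `f j` of `I` take values
in `P ⧸ I`, and their diagonal values stay nonzero at every `Q` off one hypersurface. Applied to a
relation modulo `𝔪_Q²`, they show that the `f j` are independent in the cotangent space of `P_Q`. -/
lemma exists_notMem_isRegularLocalRing_quotient (F : Type*) {P : Type*} [Field F] [PerfectField F]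
    [CommRing P] [Algebra F P] [IsRegularRing P] [Module.Projective P Ω[P⁄F]]
    (I : Ideal P) [I.IsPrime] :
    ∃ h ∉ I, ∀ (Q : Ideal P) [Q.IsPrime], I ≤ Q → h ∉ Q →
      IsRegularLocalRing (Localization.AtPrime Q ⧸ I.map (algebraMap P (Localization.AtPrime Q))) := by
  obtain ⟨r, f, D, hfI, hD, hmap⟩ := exists_derivations_residueField F I
  obtain ⟨m, hm, hmI⟩ := exists_mul_mem_of_map_le (S := Localization.AtPrime I) I.primeCompl I
    (Ideal.span (Set.range f)) (IsNoetherian.noetherian I) hmap.le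
  have (i : Fin r) := exists_linearMap_quotient_of_projective (K := I.ResidueField) I
    (D i).liftKaehlerDifferential (fun j => KaehlerDifferential.D F P (f j))
  choose c hc l hl using this
  let E (i) : Derivation F P (P ⧸ I) := (l i).compDer (KaehlerDifferential.D F P)
  have hE (i j) : E i (f j) = 0 ↔ i ≠ j := by
    have := hl i j
    rw [Derivation.liftKaehlerDifferential_comp_D] at this
    rw [← hD, ← (IsFractionRing.injective (P ⧸ I) I.ResidueField).eq_iff, map_zero]
    change algebraMap _ _ (l i (KaehlerDifferential.D F P (f j))) = 0 ↔ _
    rw [this, Algebra.smul_def, mul_eq_zero, Ideal.algebraMap_residueField_eq_zero,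
      or_iff_right (hc i)]
  have (i : Fin r) : ∃ e : P, Ideal.Quotient.mk I e = E i (f i) := Ideal.Quotient.mk_surjective _
  choose e he using this
  have heI (i) : e i ∉ I := by
    rw [← Ideal.Quotient.eq_zero_iff_mem, he, hE]; simp
  refine ⟨m * ∏ i, e i, ?_, fun Q _ hIQ hQ => ?_⟩
  · intro h
    rcases Ideal.IsPrime.mem_or_mem ‹_› h with h | h
    · exact hm h
    · obtain ⟨i, -, hi⟩ := (Ideal.IsPrime.prod_mem_iff).mp h
      exact heI i hi
  let S := Localization.AtPrime Q
  have hmQ : m ∉ Q := fun h => hQ (Q.mul_mem_right _ h)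
  have heQ (i) : e i ∉ Q := fun h => hQ (Q.mul_mem_left _ (Ideal.mem_of_dvd _
    (Finset.dvd_prod_of_mem e (Finset.mem_univ i)) h))
  have hspan : I.map (algebraMap P S) = Ideal.span (Set.range fun j => algebraMap P S (f j)) := by
    have h1 : Ideal.span (Set.range fun j => algebraMap P S (f j)) =
        (Ideal.span (Set.range f)).map (algebraMap P S) := by
      rw [Ideal.map_span, ← Set.range_comp]; rfl
    rw [h1]
    refine le_antisymm ?_ (Ideal.map_mono ?_)
    · rw [Ideal.map_le_iff_le_comap]
      intro x hx
      exact (IsLocalization.algebraMap_mem_map_algebraMap_iff Q.primeCompl S _ x).mpr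
        ⟨m, hmQ, hmI x hx⟩
    · rw [Ideal.span_le]; rintro _ ⟨j, rfl⟩; exact hfI j
  rw [hspan]
  have hfQ (j) : algebraMap P S (f j) ∈ maximalIdeal S :=
    (IsLocalization.AtPrime.to_map_mem_maximal_iff S Q (f j)).mpr (hIQ (hfI j))
  refine isRegularLocalRing_quotient_span _ hfQ ?_
  rw [Fintype.linearIndependent_iff]
  intro a ha i
  have (j : Fin r) : ∃ u : S, residue S u = a j := residue_surjective _
  choose u hu using this
  obtain ⟨t, ht⟩ := IsLocalization.exist_integer_multiples_of_finite Q.primeCompl u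
  choose p hp using ht
  have hsum : algebraMap P S (∑ j, p j * f j) ∈ maximalIdeal S ^ 2 := by
    have h1 : (maximalIdeal S).toCotangent (∑ j, u j • ⟨algebraMap P S (f j), hfQ j⟩) = 0 := by
      rw [map_sum, ← ha]
      refine Finset.sum_congr rfl fun j _ => ?_
      rw [map_smul, ← hu]; rfl
    rw [Ideal.toCotangent_eq_zero] at h1
    have h2 := Ideal.mul_mem_left _ (algebraMap P S t) h1
    convert h2 using 1
    rw [map_sum, AddSubmonoidClass.coe_finsetSum, Finset.mul_sum]
    refine Finset.sum_congr rfl fun j _ => ?_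
    rw [map_mul, hp]
    simp [Algebra.smul_def, mul_assoc]
  -- Modulo `Q`, the derivation `E i` extracts from `∑ p j * f j` the single term `p i * e i`, and
  -- `e i ∉ Q`.
  let E' : Derivation F P (P ⧸ Q) := ((Ideal.Quotient.factorₐ P hIQ).toLinearMap).compDer (E i)
  obtain ⟨m', hm', hsum⟩ := (algebraMap_mem_maximalIdeal_sq_iff Q).mp hsum
  have h0 := derivation_eq_zero_of_mul_mem_sq Q E' hm' hsum
  have hE' (x) : E' x = Ideal.Quotient.factor hIQ (E i x) := rfl
  rw [hE', map_sum, map_sum, Finset.sum_eq_single i] at h0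
  · rw [Derivation.leibniz, map_add, ← he] at h0
    have h1 : Ideal.Quotient.factor hIQ (f i • E i (p i)) = 0 := by
      rw [Algebra.smul_def, map_mul]
      have : Ideal.Quotient.factor hIQ (algebraMap P (P ⧸ I) (f i)) = 0 :=
        Ideal.Quotient.eq_zero_iff_mem.mpr (hIQ (hfI i))
      rw [this, zero_mul]
    rw [h1, add_zero] at h0
    change Ideal.Quotient.factor hIQ (Ideal.Quotient.mk I (p i * e i)) = 0 at h0
    rw [Ideal.Quotient.factor_mk, Ideal.Quotient.eq_zero_iff_mem] at h0
    have hpQ := (Ideal.IsPrime.mem_or_mem ‹_› h0).resolve_right (heQ i)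
    have h2 : t.1 • u i ∈ maximalIdeal S := by
      rw [← hp]
      exact (IsLocalization.AtPrime.to_map_mem_maximal_iff S Q _).mpr hpQ
    rw [← hu, residue_eq_zero_iff]
    rw [Algebra.smul_def] at h2
    exact (Ideal.unit_mul_mem_iff_mem _ (IsLocalization.map_units S t)).mp h2
  · intro j _ hj
    rw [Derivation.leibniz, (hE i j).mpr hj.symm, smul_zero, zero_add, Algebra.smul_def, map_mul]
    have : Ideal.Quotient.factor hIQ (algebraMap P (P ⧸ I) (f j)) = 0 :=
      Ideal.Quotient.eq_zero_iff_mem.mpr (hIQ (hfI j))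
    rw [this, zero_mul]
  · simp

end GenericRegularity

/-! ### Finiteness of the singular points of codimension `a + 1` -/

section RegularLocus

open IsLocalRing Algebra

lemma height_add_ringKrullDim_quotient_le {R : Type*} [CommRing R] (J : Ideal R) [J.IsPrime] :
    J.height + ringKrullDim (R ⧸ J) ≤ ringKrullDim R := by
  have hJ : J.height = Order.height (⟨J, ‹_›⟩ : PrimeSpectrum R) :=
    (PrimeSpectrum.height_eq_orderHeight (⟨J, ‹_›⟩ : PrimeSpectrum R))
  have : Nonempty (PrimeSpectrum R) := ⟨⟨J, ‹_›⟩⟩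
  have h : PrimeSpectrum.zeroLocus (J : Set R) = Set.Ici (⟨J, ‹_›⟩ : PrimeSpectrum R) := rfl
  rw [hJ, ringKrullDim_quotient, h, ← Order.coheight_eq_krullDim_Ici, ringKrullDim,
    Order.krullDim_eq_iSup_height_add_coheight_of_nonempty]
  exact_mod_cast le_iSup (fun a : PrimeSpectrum R => Order.height a + Order.coheight a) ⟨J, ‹_›⟩

/-- A Noetherian local ring is regular if some prime `J` is generated by `ht J` elements and the
quotient by `J` is regular. -/
lemma isRegularLocalRing_of_quotient {R : Type*} [CommRing R] [IsLocalRing R] [IsNoetherianRing R]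
    (J : Ideal R) [J.IsPrime] (s : Finset R) (hs : Ideal.span (s : Set R) = J)
    (hcard : s.card ≤ J.height) [IsRegularLocalRing (R ⧸ J)] : IsRegularLocalRing R := by
  classical
  refine IsRegularLocalRing.of_spanFinrank_maximalIdeal_le _ ?_
  obtain ⟨t, htc, ht⟩ := Submodule.FG.exists_span_finset_card_eq_spanFinrank
    (IsNoetherian.noetherian (maximalIdeal (R ⧸ J)))
  have hreg := (isRegularLocalRing_iff (R ⧸ J)).mp inferInstance
  have (x : R ⧸ J) := Ideal.Quotient.mk_surjective x
  choose l hl using this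
  have hmax : maximalIdeal R = Ideal.span ((s ∪ t.image l : Finset R) : Set R) := by
    have h1 : maximalIdeal R = (maximalIdeal (R ⧸ J)).comap (Ideal.Quotient.mk J) := by
      exact (IsLocalRing.eq_maximalIdeal
        (Ideal.comap_isMaximal_of_surjective _ Ideal.Quotient.mk_surjective)).symm
    have h2 : maximalIdeal (R ⧸ J) = (Ideal.span (t.image l : Set R)).map (Ideal.Quotient.mk J) := by
      rw [Ideal.map_span, Finset.coe_image, ← Set.image_comp]
      have : (Ideal.Quotient.mk J) ∘ l = _root_.id := funext hl
      rw [this, Set.image_id]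
      exact ht.symm
    rw [h1, h2, Ideal.comap_map_of_surjective _ Ideal.Quotient.mk_surjective, Finset.coe_union,
      Ideal.span_union, hs, sup_comm]
    congr 1
    exact Ideal.mk_ker
  have h3 : (maximalIdeal R).spanFinrank ≤ s.card + t.card := by
    rw [hmax]
    refine (Submodule.spanFinrank_span_le_ncard_of_finite (Finset.finite_toSet _)).trans ?_
    rw [Set.ncard_coe_finset]
    exact (Finset.card_union_le _ _).trans (by gcongr; exact Finset.card_image_le)
  have h4 := height_add_ringKrullDim_quotient_le J
  rw [← hreg, ← htc] at h4
  refine le_trans ?_ h4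
  refine (Nat.cast_le.mpr h3).trans ?_
  push_cast
  gcongr
  exact_mod_cast hcard

/-- `A` is a quotient of a polynomial ring `P` over `k`. Differentiating over the prime field, which
is perfect, handles imperfect `k`: `P` is formally smooth over it, so its differentials are
projective, though possibly of infinite rank. -/
lemma exists_notMem_isRegularLocalRing_quotient_of_finiteType (k : Type*) {A : Type*} [Field k]
    [CommRing A] [Algebra k A] [FiniteType k A] (p : Ideal A) [p.IsPrime] :
    ∃ h ∉ p, ∀ (q : Ideal A) [q.IsPrime], p ≤ q → h ∉ q →
      IsRegularLocalRing (Localization.AtPrime q ⧸ p.map (algebraMap A (Localization.AtPrime q))) := by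
  obtain ⟨n, φ, hφ⟩ := FiniteType.iff_quotient_mvPolynomial''.mp ‹FiniteType k A›
  let P := MvPolynomial (Fin n) k
  let I : Ideal P := p.comap φ
  obtain ⟨h, hI, H⟩ : ∃ h ∉ I, ∀ (Q : Ideal P) [Q.IsPrime], I ≤ Q → h ∉ Q →
      IsRegularLocalRing (Localization.AtPrime Q ⧸ I.map (algebraMap P (Localization.AtPrime Q))) := by
    have main (F : Type) [Field F] [PerfectField F] [Algebra F k] : ∃ h ∉ I,
        ∀ (Q : Ideal P) [Q.IsPrime], I ≤ Q → h ∉ Q →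
        IsRegularLocalRing (Localization.AtPrime Q ⧸ I.map (algebraMap P (Localization.AtPrime Q))) := by
      have := formallySmooth_of_perfectField F k
      have : FormallySmooth F P := .comp F k P
      exact exists_notMem_isRegularLocalRing_quotient F I
    obtain ⟨c, hc⟩ := CharP.exists k
    rcases CharP.char_is_prime_or_zero k c with hp | rfl
    · have : Fact c.Prime := ⟨hp⟩
      let := ZMod.algebra k c
      exact main (ZMod c)
    · have := CharP.charP_to_charZero k
      exact main ℚ
  refine ⟨φ h, hI, fun q _ hpq hq => ?_⟩
  let Q : Ideal P := q.comap φ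
  have := H Q (Ideal.comap_mono hpq) hq
  let S := Localization.AtPrime Q
  let T := Localization.AtPrime q
  let ψ : S →+* T := Localization.localRingHom Q q φ.toRingHom rfl
  have hψ (a : P) : ψ (algebraMap P S a) = algebraMap A T (φ a) :=
    Localization.localRingHom_to_map _ _ _ _ _
  have hψs : Function.Surjective ψ := by
    intro y
    obtain ⟨⟨a, s⟩, hy⟩ := IsLocalization.surj q.primeCompl y
    obtain ⟨a, rfl⟩ := hφ a
    obtain ⟨s', hs'⟩ := hφ s
    have hs'Q : s' ∈ Q.primeCompl := fun h => s.2 (hs' ▸ h)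
    refine ⟨IsLocalization.mk' S a ⟨s', hs'Q⟩, ?_⟩
    refine (IsLocalization.map_units T s).mul_left_injective ?_
    change _ * algebraMap A T s = y * algebraMap A T s
    change y * algebraMap A T s = algebraMap A T (φ a) at hy
    rw [hy, ← hs', ← hψ, ← hψ, ← map_mul]
    congr 1
    exact IsLocalization.mk'_spec S a ⟨s', hs'Q⟩
  let θ : S →+* T ⧸ p.map (algebraMap A T) := (Ideal.Quotient.mk _).comp ψ
  have hθ : Function.Surjective θ := Ideal.Quotient.mk_surjective.comp hψs
  have hker : I.map (algebraMap P S) = RingHom.ker θ := by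
    refine le_antisymm ?_ fun x hx => ?_
    · rw [Ideal.map_le_iff_le_comap]
      intro a ha
      rw [Ideal.mem_comap, RingHom.mem_ker, RingHom.comp_apply, hψ, Ideal.Quotient.eq_zero_iff_mem]
      exact Ideal.mem_map_of_mem _ ha
    · obtain ⟨⟨a, s⟩, hy⟩ := IsLocalization.surj Q.primeCompl x
      change x * algebraMap P S s = algebraMap P S a at hy
      have h1 : θ (algebraMap P S a) = 0 := by
        rw [← hy, map_mul, RingHom.mem_ker.mp hx, zero_mul]
      rw [RingHom.comp_apply, hψ, Ideal.Quotient.eq_zero_iff_mem,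
        IsLocalization.algebraMap_mem_map_algebraMap_iff q.primeCompl] at h1
      obtain ⟨m, hm, hma⟩ := h1
      have ha : a ∈ I := (Ideal.IsPrime.mem_or_mem ‹p.IsPrime› hma).resolve_left
        fun h => hm (hpq h)
      have := Ideal.mem_map_of_mem (algebraMap P S) ha
      rw [← hy] at this
      exact (Ideal.mul_unit_mem_iff_mem _ (IsLocalization.map_units S s)).mp this
  let e : S ⧸ I.map (algebraMap P S) ≃+* T ⧸ p.map (algebraMap A T) :=
    (Ideal.quotEquivOfEq hker).trans (RingHom.quotientKerEquivOfSurjective hθ)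
  exact IsRegularLocalRing.of_ringEquiv (R := S ⧸ I.map (algebraMap P S)) e

/-- The regular locus of an algebra of finite type over a field contains a dense open subset of the
closure of each of its points. -/
lemma exists_notMem_isRegularLocalRing (k : Type*) {A : Type*} [Field k]
    [CommRing A] [Algebra k A] [FiniteType k A] (p : Ideal A) [p.IsPrime]
    [IsRegularLocalRing (Localization.AtPrime p)] :
    ∃ h ∉ p, ∀ (q : Ideal A) [q.IsPrime], p ≤ q → h ∉ q →
      IsRegularLocalRing (Localization.AtPrime q) := by
  classical
  have : IsNoetherianRing A := FiniteType.isNoetherianRing k A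
  obtain ⟨h, hp, H⟩ := exists_notMem_isRegularLocalRing_quotient_of_finiteType k p
  let R := Localization.AtPrime p
  obtain ⟨t, htc, ht⟩ := Submodule.FG.exists_span_finset_card_eq_spanFinrank
    (IsNoetherian.noetherian (maximalIdeal R))
  have htcard : (t.card : WithBot ℕ∞) = p.height := by
    rw [htc, (isRegularLocalRing_iff R).mp inferInstance,
      IsLocalization.AtPrime.ringKrullDim_eq_height p R]
  have (x : R) : ∃ (a : A) (s : p.primeCompl), x * algebraMap A R s = algebraMap A R a := by
    obtain ⟨⟨a, s⟩, h⟩ := IsLocalization.surj p.primeCompl x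
    exact ⟨a, s, h⟩
  choose num den hnum using this
  -- The numerators of `ht p` generators of the maximal ideal of `A_p` generate `p` after inverting
  -- a single `m ∉ p`.
  let u : Finset A := t.image num
  have hup : Ideal.span (u : Set A) ≤ p := by
    rw [Ideal.span_le]
    intro a ha
    obtain ⟨x, hx, rfl⟩ := Finset.mem_image.mp ha
    rw [SetLike.mem_coe, ← IsLocalization.AtPrime.to_map_mem_maximal_iff R p, ← hnum]
    exact Ideal.mul_mem_right _ _ (ht ▸ Submodule.subset_span hx)
  obtain ⟨m, hm, hmp⟩ := exists_mul_mem_of_map_le (S := R) p.primeCompl p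
    (Ideal.span (u : Set A)) (IsNoetherian.noetherian p) (by
      rw [Localization.AtPrime.map_eq_maximalIdeal]
      refine ht.symm.le.trans (Submodule.span_le.mpr fun x hx => ?_)
      have := Ideal.mem_map_of_mem (algebraMap A R) (Ideal.subset_span
        (Finset.mem_image_of_mem num hx) : num x ∈ Ideal.span (u : Set A))
      rw [← hnum] at this
      exact (Ideal.mul_unit_mem_iff_mem _ (IsLocalization.map_units R (den x))).mp this)
  refine ⟨h * m, fun h' => ?_, fun q _ hpq hq => ?_⟩
  · exact (Ideal.IsPrime.mem_or_mem ‹_› h').elim hp hm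
  let S := Localization.AtPrime q
  have hmq : m ∉ q := fun h' => hq (q.mul_mem_left _ h')
  have := H q hpq fun h' => hq (q.mul_mem_right _ h')
  have hdisj : Disjoint (q.primeCompl : Set A) p :=
    Set.disjoint_left.mpr fun x hx hxp => hx (hpq hxp)
  have hprime : (p.map (algebraMap A S)).IsPrime :=
    IsLocalization.isPrime_of_isPrime_disjoint q.primeCompl S p ‹_› hdisj
  refine isRegularLocalRing_of_quotient (p.map (algebraMap A S)) (u.image (algebraMap A S)) ?_ ?_
  · rw [Finset.coe_image, ← Ideal.map_span]
    refine le_antisymm (Ideal.map_mono hup) ?_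
    rw [Ideal.map_le_iff_le_comap]
    intro x hx
    exact (IsLocalization.algebraMap_mem_map_algebraMap_iff q.primeCompl S _ x).mpr
      ⟨m, hmq, hmp x hx⟩
  · rw [IsLocalization.height_map_of_disjoint q.primeCompl p hdisj]
    refine le_trans ?_ (WithBot.coe_le_coe.mp htcard.le)
    exact_mod_cast Finset.card_image_le.trans Finset.card_image_le

/-- Noetherian induction on the closed set `V(I)`: an irreducible one may be replaced by its proper
closed subsets `V(I, h)`, and a reducible one is `V(I, x) ∪ V(I, y)`. -/
lemma ideal_induction {A : Type*} [CommRing A] [IsNoetherianRing A] {motive : Ideal A → Prop}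
    (top : motive ⊤)
    (prime : ∀ I : Ideal A, I.IsPrime → (∀ h ∉ I, motive (I ⊔ Ideal.span {h})) → motive I)
    (split : ∀ (I : Ideal A) (x y : A), x * y ∈ I → motive (I ⊔ Ideal.span {x}) →
      motive (I ⊔ Ideal.span {y}) → motive I) (I : Ideal A) : motive I := by
  induction I using WellFoundedGT.induction with
  | ind I ih =>
    have ih' (h) (hh : h ∉ I) : motive (I ⊔ Ideal.span {h}) :=
      ih _ (left_lt_sup.mpr fun hle => hh (hle (Ideal.mem_span_singleton_self h)))
    by_cases hI : I.IsPrime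
    · exact prime I hI ih'
    by_cases htop : I = ⊤
    · exact htop ▸ top
    rw [Ideal.isPrime_iff, not_and_or] at hI
    simp only [htop, not_not, false_or, not_forall] at hI
    obtain ⟨x, y, hxy, h⟩ := hI
    rw [not_or] at h
    exact split I x y hxy (ih' x h.1) (ih' y h.2)

lemma finite_setOf_not_isRegularLocalRing (k : Type*) {A : Type*} [Field k]
    [CommRing A] [Algebra k A] [FiniteType k A] (a : ℕ)
    (hA : ∀ (q : Ideal A) [q.IsPrime], q.height ≤ a → IsRegularLocalRing (Localization.AtPrime q)) :
    {q : PrimeSpectrum A | q.asIdeal.height = a + 1 ∧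
      ¬ IsRegularLocalRing (Localization.AtPrime q.asIdeal)}.Finite := by
  have : IsNoetherianRing A := FiniteType.isNoetherianRing k A
  set s := {q : PrimeSpectrum A | q.asIdeal.height = a + 1 ∧
      ¬ IsRegularLocalRing (Localization.AtPrime q.asIdeal)} with hs
  suffices ∀ I : Ideal A, {q ∈ s | I ≤ q.asIdeal}.Finite by simpa using this ⊥
  intro I
  induction I using ideal_induction with
  | top =>
    convert Set.finite_empty (α := PrimeSpectrum A)
    rw [Set.eq_empty_iff_forall_notMem]
    rintro q ⟨-, hq⟩
    exact q.isPrime.ne_top (top_le_iff.mp hq)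
  | prime I hI ih =>
    by_cases hreg : IsRegularLocalRing (Localization.AtPrime I)
    · obtain ⟨h, hhI, H⟩ := exists_notMem_isRegularLocalRing k I
      refine (ih h hhI).subset ?_
      rintro q ⟨hq, hIq⟩
      refine ⟨hq, sup_le hIq ((Ideal.span_singleton_le_iff_mem _).mpr ?_)⟩
      by_contra hh
      exact hq.2 (H q.asIdeal hIq hh)
    -- A prime of height `a + 1` strictly above `I` would force `ht I ≤ a`, hence regularity at `I`;
    -- only `I` itself can remain.
    · refine (Set.finite_singleton (⟨I, hI⟩ : PrimeSpectrum A)).subset ?_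
      rintro q ⟨hq, hIq⟩
      by_contra hne
      have hlt : I < q.asIdeal := lt_of_le_of_ne hIq fun h => hne (PrimeSpectrum.ext h.symm)
      refine hreg (hA I ?_)
      have h1 := Ideal.height_add_one_le_of_lt_of_isPrime hlt
      rw [hq.1] at h1
      exact (ENat.add_le_add_iff_right ENat.one_ne_top).mp h1
  | split I x y hxy hx hy =>
    refine (hx.union hy).subset ?_
    rintro q ⟨hq, hIq⟩
    rcases q.isPrime.mem_or_mem (hIq hxy) with hx | hy
    · exact Or.inl ⟨hq, sup_le hIq ((Ideal.span_singleton_le_iff_mem _).mpr hx)⟩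
    · exact Or.inr ⟨hq, sup_le hIq ((Ideal.span_singleton_le_iff_mem _).mpr hy)⟩

end RegularLocus

/-! ### Transcendence degree, differentials, and linear forms -/

section LinearForms

open Algebra TensorProduct

open scoped IntermediateField.algebraAdjoinAdjoin in
-- If the differentials `dx` form a basis of `Ω[K⁄k]`, then `K` is unramified over `k(x)`, hence
-- separable algebraic over it. Equality may fail over imperfect fields, but this inequality is all
-- the dimension count needs.
lemma trdeg_le_finrank_kaehlerDifferential (k K : Type*) [Field k] [Field K] [Algebra k K]
    [EssFiniteType k K] : trdeg k K ≤ Module.finrank K Ω[K⁄k] := by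
  obtain ⟨b, hb, hspan, hli⟩ := exists_linearIndependent K (Set.range (KaehlerDifferential.D k K))
  rw [KaehlerDifferential.span_range_derivation] at hspan
  have hbfin : Finite b := hli.finite
  choose x hx using fun y : b => hb y.2
  let s : Set K := Set.range x
  let L := IntermediateField.adjoin k s
  have hsub : Subsingleton Ω[K⁄L] := by
    have h0 : KaehlerDifferential.map k L K K = 0 := by
      refine LinearMap.ext_on hspan fun y hy => ?_
      have h1 : x ⟨y, hy⟩ = algebraMap L K ⟨x ⟨y, hy⟩, IntermediateField.subset_adjoin k s ⟨_, rfl⟩⟩ :=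
        rfl
      have h2 : y = KaehlerDifferential.D k K (x ⟨y, hy⟩) := (hx ⟨y, hy⟩).symm
      rw [h2, KaehlerDifferential.map_D, algebraMap_self_apply, h1, Derivation.map_algebraMap]
      rfl
    refine subsingleton_of_forall_eq 0 fun y => ?_
    obtain ⟨z, rfl⟩ := KaehlerDifferential.map_surjective k L K y
    rw [h0]; rfl
  have : FormallyUnramified L K := ⟨hsub⟩
  have : EssFiniteType L K := .of_comp k L K
  have : Algebra.IsSeparable L K := FormallyUnramified.isSeparable L K
  have : Algebra.IsAlgebraic (adjoin k s) K :=
    (IsFractionRing.comap_isAlgebraic_iff (K := L)).mpr inferInstance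
  refine (IsAlgebraic.trdeg_le_cardinalMk k s).trans ?_
  have h2 : Module.finrank K Ω[K⁄k] = Nat.card b := by
    rw [← finrank_top K Ω[K⁄k], ← hspan]
    have := Fintype.ofFinite b
    rw [finrank_span_set_eq_card hli, Set.toFinset_card, Nat.card_eq_fintype_card]
  rw [h2, Nat.cast_card]
  exact Cardinal.mk_range_le

lemma formallyUnramified_residueField {A : Type*} [CommRing A] (p : Ideal A) [p.IsPrime] :
    FormallyUnramified A p.ResidueField := by
  have : FormallyUnramified A (Localization.AtPrime p) := .of_isLocalization p.primeCompl
  have : FormallyUnramified (Localization.AtPrime p) p.ResidueField :=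
    .of_surjective (IsScalarTower.toAlgHom _ _ _) IsLocalRing.residue_surjective
  exact .comp A (Localization.AtPrime p) p.ResidueField

lemma trdeg_residueField_le (k : Type*) {A : Type*} [Field k] [CommRing A] [Algebra k A]
    [FiniteType k A] (p : Ideal A) [p.IsPrime] :
    trdeg k p.ResidueField ≤ Module.finrank p.ResidueField (p.ResidueField ⊗[A] Ω[A⁄k]) := by
  have : EssFiniteType (Localization.AtPrime p) p.ResidueField :=
    .of_surjective (IsScalarTower.toAlgHom _ (Localization.AtPrime p) _) IsLocalRing.residue_surjective
  have : EssFiniteType k p.ResidueField := .comp k (Localization.AtPrime p) _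
  refine (trdeg_le_finrank_kaehlerDifferential k p.ResidueField).trans ?_
  have := formallyUnramified_residueField p
  have hs : Function.Surjective (KaehlerDifferential.mapBaseChange k A p.ResidueField) := fun y =>
    (KaehlerDifferential.exact_mapBaseChange_map k A p.ResidueField y).mp (Subsingleton.elim _ _)
  exact_mod_cast LinearMap.finrank_le_finrank_of_surjective hs

open MvPolynomial in
/-- Over a field extension `K` of `k`, more than `trdeg k K` linearly independent linear forms
generate an ideal of `K[λ]` that contains a nonzero polynomial with coefficients in `k`. -/
lemma exists_map_eq_sum_linearForm_mul {k K : Type*} [Field k] [Field K] [Algebra k K] {r N : ℕ}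
    (hr : trdeg k K < r) (R : Fin r → Fin N → K) (hR : LinearIndependent K R) :
    ∃ (Φ : MvPolynomial (Fin N) k) (G : Fin r → MvPolynomial (Fin N) K), Φ ≠ 0 ∧
      map (algebraMap k K) Φ = ∑ i, G i * ∑ j, C (R i j) * X j := by
  let ρ : (Fin N → K) →ₗ[K] (Fin r → K) := Matrix.mulVecLin (Matrix.of R)
  have hρ : Function.Surjective ρ := by
    rw [← LinearMap.range_eq_top]
    refine Submodule.eq_top_of_finrank_eq ?_
    rw [Module.finrank_fin_fun]
    simpa [Matrix.rank, ρ] using LinearIndependent.rank_matrix (M := Matrix.of R) hR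
  obtain ⟨E, hE⟩ := ρ.exists_rightInverse_of_surjective (LinearMap.range_eq_top.mpr hρ)
  let V := LinearMap.ker ρ
  let b := Module.finBasis K V
  set m := Module.finrank K V with hm
  have hmN : m + r = N := by
    have := ρ.finrank_range_add_finrank_ker
    rw [LinearMap.range_eq_top.mpr hρ, finrank_top] at this
    simp only [Module.finrank_fin_fun] at this
    change r + m = N at this
    omega
  let φ : MvPolynomial (Fin N) K →ₐ[K] MvPolynomial (Fin m) K :=
    aeval fun j => ∑ t, C ((b t : Fin N → K) j) * X t
  -- Setting the `r` forms to zero leaves `m = N - r` variables over `K`, of transcendence degree `m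
  -- + trdeg K < N` over `k`; the `N` images of the variables must be dependent.
  have hnot : ¬ AlgebraicIndependent k (fun j => φ (X j)) := by
    intro h
    have h1 := h.lift_cardinalMk_le_trdeg
    rw [← trdeg_add_eq k K, MvPolynomial.trdeg_of_isDomain] at h1
    obtain ⟨t, ht⟩ := Cardinal.lt_aleph0.mp (hr.trans Cardinal.natCast_lt_aleph0)
    rw [ht] at h1 hr
    simp only [Cardinal.mk_fintype, Fintype.card_fin, Cardinal.lift_natCast,
      ← Nat.cast_add, Nat.cast_le, Nat.cast_lt] at h1 hr
    omega
  rw [algebraicIndependent_iff] at hnot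
  push Not at hnot
  obtain ⟨Φ, hΦ, hΦ0⟩ := hnot
  have hφ : φ (map (algebraMap k K) Φ) = 0 := by
    rw [← hΦ, aeval_map_algebraMap]
    simp only [φ, aeval_X]
  let J : Ideal (MvPolynomial (Fin N) K) := Ideal.span (Set.range fun i => ∑ j, C (R i j) * X j)
  let π : (Fin N → K) →ₗ[K] V := (LinearMap.id - E.comp ρ).codRestrict V fun v => by
    have : ρ (E (ρ v)) = ρ v := LinearMap.congr_fun hE (ρ v)
    simp [V, this]
  let ψ : MvPolynomial (Fin m) K →ₐ[K] MvPolynomial (Fin N) K :=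
    aeval fun t => ∑ l, C (b.repr (π (Pi.single l 1)) t) * X l
  -- `ψ` inverts `φ` modulo `J`, so the kernel of `φ` lies in `J`.
  have hcomp : ((Ideal.Quotient.mkₐ K J).comp ψ).comp φ = Ideal.Quotient.mkₐ K J := by
    ext j
    refine Ideal.Quotient.eq.mpr ?_
    have h1 : ψ (φ (X j)) = ∑ l, C ((π (Pi.single l 1) : Fin N → K) j) * X l := by
      simp only [φ, ψ, aeval_X, map_sum, map_mul, algHom_C, Finset.mul_sum]
      rw [Finset.sum_comm]
      refine Finset.sum_congr rfl fun l _ => ?_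
      have h2 : (π (Pi.single l 1) : Fin N → K) j =
          ∑ t, (b t : Fin N → K) j * b.repr (π (Pi.single l 1)) t := by
        have := congrArg (fun v : V => (v : Fin N → K) j) (b.sum_repr (π (Pi.single l 1)))
        simp only [Submodule.coe_sum, Finset.sum_apply] at this
        rw [← this]
        simp [mul_comm]
      rw [h2, map_sum, Finset.sum_mul]
      refine Finset.sum_congr rfl fun t _ => ?_
      simp [mul_assoc, algebraMap_eq]
    have h3 (l) : (π (Pi.single l 1) : Fin N → K) j =
        (Pi.single l 1 : Fin N → K) j - ∑ i, E (Pi.single i 1) j * R i l := by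
      have h4 : E (ρ (Pi.single l 1)) = ∑ i, R i l • E (Pi.single i 1) := by
        have h5 : ρ (Pi.single l 1) = ∑ i, R i l • (Pi.single i 1 : Fin r → K) := by
          ext i
          simp [ρ, Finset.sum_apply, Pi.single_apply]
        rw [h5, map_sum]
        simp only [map_smul]
      change (Pi.single l 1 : Fin N → K) j - E (ρ (Pi.single l 1)) j = _
      rw [h4, Finset.sum_apply]
      simp [mul_comm]
    change ψ (φ (X j)) - X j ∈ J
    have h5 : ψ (φ (X j)) - X j = -∑ i, C (E (Pi.single i 1) j) * ∑ l, C (R i l) * X l := by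
      rw [h1]
      simp only [h3, map_sub, sub_mul, Finset.sum_sub_distrib]
      have h6 : ∑ l, C ((Pi.single l 1 : Fin N → K) j) * (X l : MvPolynomial (Fin N) K) = X j := by
        rw [Finset.sum_eq_single j]
        · simp
        · intro l _ hl; simp [Ne.symm hl]
        · simp
      rw [h6, sub_sub_cancel_left]
      congr 1
      simp only [map_sum, Finset.sum_mul, Finset.mul_sum, map_mul]
      rw [Finset.sum_comm]
      simp only [mul_assoc]
    rw [h5]
    exact neg_mem (sum_mem fun i _ => J.mul_mem_left _ (Ideal.subset_span ⟨i, rfl⟩))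
  have hmem : map (algebraMap k K) Φ ∈ J := by
    rw [← Ideal.Quotient.eq_zero_iff_mem]
    have := DFunLike.congr_fun hcomp (map (algebraMap k K) Φ)
    rw [AlgHom.comp_apply, hφ, map_zero] at this
    exact this.symm
  obtain ⟨G, hG⟩ := Ideal.mem_span_range_iff_exists_fun.mp hmem
  exact ⟨Φ, G, hΦ0, hG.symm⟩

end LinearForms

/-! ### The general section is nowhere in the square of the maximal ideal -/

section GeneralMember

open Algebra TensorProduct

/-- Generators of `M` have a common denominator, so finiteness replaces projectivity and the scaling
is valid on all of `M`. -/
lemma exists_linearMap_quotient_of_finite {A M K : Type*} [CommRing A] (p : Ideal A)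
    [p.IsPrime] [Field K] [Algebra A K] [Algebra (A ⧸ p) K] [IsScalarTower A (A ⧸ p) K]
    [IsFractionRing (A ⧸ p) K] [AddCommGroup M] [Module A M] [Module.Finite A M]
    (l : M →ₗ[A] K) :
    ∃ c ∉ p, ∃ l' : M →ₗ[A] A ⧸ p, ∀ x, algebraMap (A ⧸ p) K (l' x) = c • l x := by
  obtain ⟨T, hT⟩ := Module.Finite.fg_top (R := A) (M := M)
  obtain ⟨⟨c, hc⟩, hcT⟩ := IsLocalization.exist_integer_multiples (nonZeroDivisors (A ⧸ p)) T
    (fun m => l m)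
  obtain ⟨c, rfl⟩ := Ideal.Quotient.mk_surjective c
  have hcp : c ∉ p := by
    intro h
    rw [Ideal.Quotient.eq_zero_iff_mem.mpr h] at hc
    exact zero_notMem_nonZeroDivisors hc
  let j : A ⧸ p →ₗ[A] K := (IsScalarTower.toAlgHom A (A ⧸ p) K).toLinearMap
  have hj : Function.Injective j := IsFractionRing.injective (A ⧸ p) K
  have hrange (x : M) : (c • l) x ∈ LinearMap.range j := by
    have hx : x ∈ Submodule.span A (T : Set M) := hT ▸ trivial
    induction hx using Submodule.span_induction with
    | mem y hy =>
      obtain ⟨z, hz⟩ := hcT y hy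
      refine ⟨z, hz.trans ?_⟩
      change Ideal.Quotient.mk p c • l y = c • l y
      rw [Algebra.smul_def, Algebra.smul_def, IsScalarTower.algebraMap_apply A (A ⧸ p) K]
      rfl
    | zero => simp
    | add a b _ _ ha hb => rw [map_add]; exact add_mem ha hb
    | smul r a _ ha => rw [map_smul]; exact Submodule.smul_mem _ _ ha
  refine ⟨c, hcp, (LinearEquiv.ofInjective j hj).symm.toLinearMap.comp
    ((c • l).codRestrict _ hrange), fun x => ?_⟩
  exact congrArg Subtype.val
    ((LinearEquiv.ofInjective j hj).apply_symm_apply ⟨(c • l) x, hrange x⟩)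

open MvPolynomial in
/-- The generic member of a linear system that separates tangent vectors at `p` is not in the
square of any prime ideal in a dense open subset of the closure of `p`. -/
lemma exists_general_not_mem_sq_of_prime {k A : Type*} [Field k] [CommRing A] [Algebra k A]
    [FiniteType k A] {N : ℕ} (s : Fin N → A) (p : Ideal A) [p.IsPrime]
    (H : ∀ (c : p.ResidueField) (D : Derivation k A p.ResidueField),
      (∀ j, c * algebraMap A _ (s j) + D (s j) = 0) → c = 0 ∧ D = 0) :
    ∃ Φ : MvPolynomial (Fin N) k, Φ ≠ 0 ∧ ∃ h ∉ p, ∀ v : Fin N → k, eval v Φ ≠ 0 →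
      ∀ (q : Ideal A) [q.IsPrime], p ≤ q → h ∉ q → ∀ m ∉ q, m * ∑ j, v j • s j ∉ q ^ 2 := by
  let K := p.ResidueField
  let W := K ⊗[A] Ω[A⁄k]
  let b := Module.finBasis K W
  set w := Module.finrank K W with hw
  let D (i : Fin w) : Derivation k A K :=
    (((b.coord i).restrictScalars A).comp (TensorProduct.mk A K Ω[A⁄k] 1)).compDer
      (KaehlerDifferential.D k A)
  have hD (i a) : D i a = b.coord i (1 ⊗ₜ KaehlerDifferential.D k A a) := rfl
  -- Row `0` evaluates the sections at `p`, the other rows their derivatives along a basis; `H` says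
  -- exactly that the rows are independent.
  let R : Fin (w + 1) → Fin N → K := Fin.cons (fun j => algebraMap A K (s j)) fun i j => D i (s j)
  have hR : LinearIndependent K R := by
    rw [Fintype.linearIndependent_iff]
    intro g hg
    obtain ⟨h0, hD0⟩ := H (g 0) (∑ i : Fin w, g i.succ • D i) fun j => by
      have := congrFun hg j
      rw [Fin.sum_univ_succ] at this
      have h1 : (∑ i : Fin w, g i.succ • D i) (s j) = ∑ i : Fin w, g i.succ * D i (s j) := by
        have := congrFun (map_sum Derivation.coeFnAddMonoidHom (fun i : Fin w => g i.succ • D i)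
          Finset.univ) (s j)
        rw [Finset.sum_apply] at this
        exact this
      rw [h1]
      simpa [R] using this
    have hcoord : ∑ i : Fin w, g i.succ • b.coord i = 0 := by
      set f := ∑ i : Fin w, g i.succ • b.coord i with hf
      have hfD (a) : f (1 ⊗ₜ KaehlerDifferential.D k A a) = 0 := by
        have := congrFun (map_sum Derivation.coeFnAddMonoidHom (fun i : Fin w => g i.succ • D i)
          Finset.univ) a
        rw [Finset.sum_apply, hD0] at this
        simpa [hf, hD] using this.symm
      have hf0 : (f.restrictScalars A).comp (TensorProduct.mk A K Ω[A⁄k] 1) = 0 := by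
        refine LinearMap.ext_on (KaehlerDifferential.span_range_derivation k A) ?_
        rintro _ ⟨a, rfl⟩
        exact hfD a
      refine LinearMap.ext fun y => ?_
      induction y using TensorProduct.induction_on with
      | zero => simp
      | add x y hx hy => rw [map_add, hx, hy]; simp
      | tmul x y =>
        have h1 : x ⊗ₜ[A] y = x • ((1 : K) ⊗ₜ[A] y) := by rw [smul_tmul', smul_eq_mul, mul_one]
        have h2 : f (1 ⊗ₜ y) = 0 := LinearMap.congr_fun hf0 y
        rw [h1, map_smul, h2, smul_zero]; rfl
    have hli := Fintype.linearIndependent_iff.mp b.dualBasis.linearIndependent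
      (fun i => g i.succ) (by simpa using hcoord)
    intro i
    cases i using Fin.cases with
    | zero => exact h0
    | succ i => exact hli i
  obtain ⟨Φ, G, hΦ, hG⟩ := exists_map_eq_sum_linearForm_mul
    (by
      refine (trdeg_residueField_le k p).trans_lt ?_
      exact_mod_cast Nat.lt_succ_self w) R hR
  have (i : Fin w) := exists_linearMap_quotient_of_finite (K := K) p (D i).liftKaehlerDifferential
  choose c hc l hl using this
  obtain ⟨⟨h, hh⟩, hcoeff⟩ := IsLocalization.exist_integer_multiples (nonZeroDivisors (A ⧸ p))
    (Finset.univ.biUnion fun i => (G i).support.image fun d => (i, d))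
    (fun x : Fin (w + 1) × (Fin N →₀ ℕ) => coeff x.2 (G x.1))
  obtain ⟨h, rfl⟩ := Ideal.Quotient.mk_surjective h
  have hhp : h ∉ p := by
    intro h'
    rw [Ideal.Quotient.eq_zero_iff_mem.mpr h'] at hh
    exact zero_notMem_nonZeroDivisors hh
  refine ⟨Φ, hΦ, h * ∏ i, c i, fun hmem => ?_, fun v hv q _ hpq hq m hm hsq => ?_⟩
  · rcases Ideal.IsPrime.mem_or_mem ‹_› hmem with h' | h'
    · exact hhp h'
    · obtain ⟨i, -, hi⟩ := (Ideal.IsPrime.prod_mem_iff).mp h'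
      exact hc i hi
  set F := ∑ j, v j • s j with hF
  let ι : A ⧸ p →ₗ[A ⧸ p] K := Algebra.linearMap (A ⧸ p) K
  -- The copy of `q/p` inside `K = Frac(A/p)`, so that vanishing at `q` can be expressed for
  -- elements of `K`.
  let Q : Submodule (A ⧸ p) K := Submodule.map ι (q.map (Ideal.Quotient.mk p))
  have hιQ (y : A) : ι (Ideal.Quotient.mk p y) ∈ Q ↔ y ∈ q := by
    rw [← Ideal.mem_quotient_iff_mem hpq]
    refine ⟨fun ⟨z, hz, he⟩ => ?_, fun h => ⟨_, h, rfl⟩⟩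
    have hzy : z = Ideal.Quotient.mk p y := IsFractionRing.injective (A ⧸ p) K he
    rwa [← hzy]
  have hFq : F ∈ q :=
    (Ideal.IsPrime.mem_or_mem ‹_› (Ideal.pow_le_self two_ne_zero hsq)).resolve_left hm
  have hDF (i) : c i • D i F ∈ Q := by
    have h1 := hl i (KaehlerDifferential.D k A F)
    rw [Derivation.liftKaehlerDifferential_comp_D] at h1
    let E : Derivation k A (A ⧸ q) :=
      ((Ideal.Quotient.factorₐ A hpq).toLinearMap.comp (l i)).compDer (KaehlerDifferential.D k A)
    have h2 : Ideal.Quotient.factor hpq (l i (KaehlerDifferential.D k A F)) = 0 :=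
      derivation_eq_zero_of_mul_mem_sq q E hm hsq
    obtain ⟨y, hy⟩ := Ideal.Quotient.mk_surjective (l i (KaehlerDifferential.D k A F))
    rw [← hy, Ideal.Quotient.factor_mk, Ideal.Quotient.eq_zero_iff_mem] at h2
    rw [← h1, ← hy]
    exact (hιQ y).mpr h2
  have hAQ (a : A) {z : K} (hz : z ∈ Q) : a • z ∈ Q := by
    have : a • z = Ideal.Quotient.mk p a • z := by
      rw [Algebra.smul_def, Algebra.smul_def, IsScalarTower.algebraMap_apply A (A ⧸ p) K]; rfl
    rw [this]; exact Q.smul_mem _ hz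
  have hrow (i) : (∏ i, c i) • ∑ j, R i j * algebraMap k K (v j) ∈ Q := by
    cases i using Fin.cases with
    | zero =>
      have : ∑ j, R 0 j * algebraMap k K (v j) = algebraMap A K F := by
        simp [R, hF, Algebra.smul_def, mul_comm, ← IsScalarTower.algebraMap_apply]
      rw [this]
      refine hAQ _ ?_
      rw [IsScalarTower.algebraMap_apply A (A ⧸ p) K]
      exact (hιQ F).mpr hFq
    | succ i =>
      have : ∑ j, R i.succ j * algebraMap k K (v j) = D i F := by
        simp [R, hF, Algebra.smul_def, mul_comm, ← IsScalarTower.algebraMap_apply k A K]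
      rw [this, ← Finset.prod_erase_mul _ _ (Finset.mem_univ i), mul_smul]
      exact hAQ _ (hDF i)
  have hGint (i) : ∃ y : A ⧸ p, algebraMap (A ⧸ p) K y =
      h • eval (fun j => algebraMap k K (v j)) (G i) := by
    change _ ∈ (algebraMap (A ⧸ p) K).range
    rw [eval_eq, Finset.smul_sum]
    refine sum_mem fun d hd => ?_
    rw [← smul_mul_assoc]
    refine mul_mem ?_ (prod_mem fun j _ => pow_mem ?_ _)
    · obtain ⟨y, hy⟩ := hcoeff (i, d) (Finset.mem_biUnion.mpr
        ⟨i, Finset.mem_univ _, Finset.mem_image_of_mem _ hd⟩)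
      refine ⟨y, hy.trans ?_⟩
      change Ideal.Quotient.mk p h • _ = h • _
      rw [Algebra.smul_def, Algebra.smul_def, IsScalarTower.algebraMap_apply A (A ⧸ p) K]; rfl
    · exact ⟨algebraMap k (A ⧸ p) (v j), (IsScalarTower.algebraMap_apply k (A ⧸ p) K _).symm⟩
  -- `Φ(v)` is a combination of the row values. With denominators cleared by `h` and the `c i`,
  -- these lie in `Q`; as `Φ(v)` is a unit, this will force `h * ∏ c i ∈ q`.
  have hfin : (h * ∏ i, c i) • algebraMap k K (eval v Φ) ∈ Q := by
    have h1 : algebraMap k K (eval v Φ) = eval (fun j => algebraMap k K (v j))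
        (map (algebraMap k K) Φ) := by
      rw [MvPolynomial.eval_map, eval₂_comp]; rfl
    rw [h1, hG, map_sum, Finset.smul_sum]
    refine sum_mem fun i _ => ?_
    obtain ⟨y, hy⟩ := hGint i
    have h2 : (h * ∏ i, c i) • eval (fun j => algebraMap k K (v j))
        (G i * ∑ j, C (R i j) * X j) = y • ((∏ i, c i) • ∑ j, R i j * algebraMap k K (v j)) := by
      rw [map_mul, Algebra.smul_def y, hy, map_sum, mul_smul, ← smul_mul_assoc, mul_comm]
      simp only [Algebra.smul_def, map_mul, map_prod, eval_C, eval_X]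
      ring
    rw [h2]
    exact Q.smul_mem _ (hrow i)
  apply hq
  have h3 : (h * ∏ i, c i) • algebraMap k K (eval v Φ) =
      ι (Ideal.Quotient.mk p ((h * ∏ i, c i) * algebraMap k A (eval v Φ))) := by
    rw [Algebra.smul_def, IsScalarTower.algebraMap_apply k A K, ← map_mul,
      IsScalarTower.algebraMap_apply A (A ⧸ p) K]; rfl
  rw [h3, hιQ] at hfin
  exact (Ideal.mul_unit_mem_iff_mem _ ((IsUnit.mk0 _ hv).map (algebraMap k A))).mp hfin

open MvPolynomial in
lemma exists_general_not_mem_sq {k A : Type*} [Field k] [CommRing A] [Algebra k A]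
    [FiniteType k A] {N : ℕ} (s : Fin N → A)
    (H : ∀ (p : Ideal A) [p.IsPrime] (c : p.ResidueField) (D : Derivation k A p.ResidueField),
      (∀ j, c * algebraMap A _ (s j) + D (s j) = 0) → c = 0 ∧ D = 0) :
    ∃ Φ : MvPolynomial (Fin N) k, Φ ≠ 0 ∧ ∀ v : Fin N → k, eval v Φ ≠ 0 →
      ∀ (q : Ideal A) [q.IsPrime], ∀ m ∉ q, m * ∑ j, v j • s j ∉ q ^ 2 := by
  have : IsNoetherianRing A := FiniteType.isNoetherianRing k A
  suffices ∀ I : Ideal A, ∃ Φ : MvPolynomial (Fin N) k, Φ ≠ 0 ∧ ∀ v : Fin N → k, eval v Φ ≠ 0 →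
      ∀ (q : Ideal A) [q.IsPrime], I ≤ q → ∀ m ∉ q, m * ∑ j, v j • s j ∉ q ^ 2 by
    simpa using this ⊥
  intro I
  induction I using ideal_induction with
  | top => exact ⟨1, one_ne_zero, fun v _ q hq h => absurd (top_le_iff.mp h) hq.ne_top⟩
  | prime I hI ih =>
    obtain ⟨Φ, hΦ, h, hh, H1⟩ := exists_general_not_mem_sq_of_prime s I (H I)
    obtain ⟨Ψ, hΨ, H2⟩ := ih h hh
    refine ⟨Φ * Ψ, mul_ne_zero hΦ hΨ, fun v hv q _ hIq => ?_⟩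
    rw [map_mul] at hv
    by_cases hq : h ∈ q
    · exact H2 v (right_ne_zero_of_mul hv) q
        (sup_le hIq ((Ideal.span_singleton_le_iff_mem _).mpr hq))
    · exact H1 v (left_ne_zero_of_mul hv) q hIq hq
  | split I x y hxy hx hy =>
    obtain ⟨Φ, hΦ, H1⟩ := hx
    obtain ⟨Ψ, hΨ, H2⟩ := hy
    refine ⟨Φ * Ψ, mul_ne_zero hΦ hΨ, fun v hv q hq' hIq => ?_⟩
    rw [map_mul] at hv
    rcases hq'.mem_or_mem (hIq hxy) with hq | hq
    · exact H1 v (left_ne_zero_of_mul hv) q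
        (sup_le hIq ((Ideal.span_singleton_le_iff_mem _).mpr hq))
    · exact H2 v (right_ne_zero_of_mul hv) q
        (sup_le hIq ((Ideal.span_singleton_le_iff_mem _).mpr hq))

open MvPolynomial in
-- A `k`-functional on `A ⧸ q` that is nonzero on `s j` turns avoidance of `q` into nonvanishing of
-- a linear form in `v`.
lemma exists_general_not_mem {k A : Type*} [Field k] [CommRing A] [Algebra k A] {N : ℕ}
    (s : Fin N → A) (q : Ideal A) (j : Fin N) (hj : s j ∉ q) :
    ∃ Φ : MvPolynomial (Fin N) k, Φ ≠ 0 ∧ ∀ v : Fin N → k, eval v Φ ≠ 0 → ∑ j, v j • s j ∉ q := by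
  obtain ⟨f, hf⟩ : ∃ f : Module.Dual k (A ⧸ q), f (Ideal.Quotient.mk q (s j)) ≠ 0 := by
    by_contra! h
    exact hj (Ideal.Quotient.eq_zero_iff_mem.mp ((Module.forall_dual_apply_eq_zero_iff k _).mp h))
  let g : A →ₗ[k] k := f.comp (Ideal.Quotient.mkₐ k q).toLinearMap
  refine ⟨∑ i, C (g (s i)) * X i, fun h => ?_, fun v hv hmem => hv ?_⟩
  · have := congrArg (eval (Pi.single j 1)) h
    rw [map_sum, Finset.sum_eq_single j] at this
    · simp only [map_mul, eval_C, eval_X, Pi.single_eq_same, mul_one, map_zero] at this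
      exact hf this
    · intro i _ hi; simp [hi]
    · simp
  · have h1 : g (∑ j, v j • s j) = 0 := by
      change f (Ideal.Quotient.mk q _) = 0
      rw [Ideal.Quotient.eq_zero_iff_mem.mpr hmem, map_zero]
    rw [← h1]
    simp [mul_comm]

end GeneralMember

/-! ### The general section cuts out an `R_a` quotient -/

section GeneralQuotient

open Algebra MvPolynomial IsLocalRing

lemma ringKrullDim_le_ringKrullDim_quotient_span_singleton_add_one {S : Type*} [CommRing S]
    [IsNoetherianRing S] [IsLocalRing S] {f : S} (hf : f ∈ maximalIdeal S) :
    ringKrullDim S ≤ ringKrullDim (S ⧸ Ideal.span {f}) + 1 := by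
  have := ringKrullDim_le_ringKrullDim_quotient_add_card {f} (R := S)
    (by simpa [IsLocalRing.ringJacobson_eq_maximalIdeal] using hf)
  rwa [Finset.coe_singleton, Finset.card_singleton, Nat.cast_one] at this

lemma isRegularLocalRing_quotient_span_singleton {S : Type*} [CommRing S]
    [IsRegularLocalRing S] {f : S} (hf : f ∈ maximalIdeal S) (hf2 : f ∉ maximalIdeal S ^ 2) :
    IsRegularLocalRing (S ⧸ Ideal.span {f}) := by
  have := isRegularLocalRing_quotient_span (R := S) (r := 1) (fun _ => f) (fun _ => hf) (by
    rw [linearIndependent_unique_iff]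
    exact fun h => hf2 ((maximalIdeal S).toCotangent_eq_zero ⟨f, hf⟩ |>.mp h))
  rwa [Set.range_const] at this

/-- The general member of a linear system that separates tangent vectors cuts out an
`R_a` quotient of an `R_a` algebra. -/
lemma exists_general_isRegularLocalRing_quotient {k : Type*} {A : Type u} [Field k] [CommRing A]
    [Algebra k A] [FiniteType k A] {N : ℕ} (s : Fin N → A)
    (H : ∀ (p : Ideal A) [p.IsPrime] (c : p.ResidueField) (D : Derivation k A p.ResidueField),
      (∀ j, c * algebraMap A _ (s j) + D (s j) = 0) → c = 0 ∧ D = 0)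
    (a : ℕ) (hA : ∀ (q : Ideal A) [q.IsPrime], q.height ≤ a →
      IsRegularLocalRing (Localization.AtPrime q)) :
    ∃ Φ : MvPolynomial (Fin N) k, Φ ≠ 0 ∧ ∀ v : Fin N → k, MvPolynomial.eval v Φ ≠ 0 →
      ∀ (q : Ideal A) [q.IsPrime] (S : Type u) [CommRing S] [Algebra A S]
        [IsLocalization.AtPrime S q], ∑ j, v j • s j ∈ q →
        ringKrullDim (S ⧸ Ideal.span {algebraMap A S (∑ j, v j • s j)}) ≤ a →
        IsRegularLocalRing (S ⧸ Ideal.span {algebraMap A S (∑ j, v j • s j)}) := by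
  have : IsNoetherianRing A := FiniteType.isNoetherianRing k A
  -- Separation with `c = 1`, `D = 0` says that the sections have no common zero.
  have hs (q : Ideal A) [hq : q.IsPrime] : ∃ j, s j ∉ q := by
    by_contra! h
    refine one_ne_zero (H q 1 0 fun j => ?_).1
    simpa using (Ideal.algebraMap_residueField_eq_zero).mpr (h j)
  have hfin := finite_setOf_not_isRegularLocalRing k (A := A) a (fun q hq => hA q)
  obtain ⟨Φ, hΦ, H1⟩ := exists_general_not_mem_sq s H
  have (q : PrimeSpectrum A) := exists_general_not_mem (k := k) s q.asIdeal _ (hs q.asIdeal).choose_spec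
  choose Ψ hΨ H2 using this
  refine ⟨Φ * ∏ q ∈ hfin.toFinset, Ψ q, mul_ne_zero hΦ (Finset.prod_ne_zero_iff.mpr
    fun q _ => hΨ q), fun v hv q hq S _ _ _ hfq hdim => ?_⟩
  rw [map_mul, map_prod, mul_ne_zero_iff, Finset.prod_ne_zero_iff] at hv
  have : IsLocalRing S := IsLocalization.AtPrime.isLocalRing S q
  have : IsNoetherianRing S := IsLocalization.isNoetherianRing q.primeCompl S inferInstance
  set f := ∑ j, v j • s j with hf
  have hfS : algebraMap A S f ∈ maximalIdeal S :=
    (IsLocalization.AtPrime.to_map_mem_maximal_iff S q f).mpr hfq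
  have hqh : q.height ≤ (a + 1 : ℕ) := by
    have h1 := ringKrullDim_le_ringKrullDim_quotient_span_singleton_add_one hfS
    rw [IsLocalization.AtPrime.ringKrullDim_eq_height q S] at h1
    have h2 := h1.trans (add_le_add_left hdim 1)
    exact_mod_cast h2
  -- In height `a + 1`, the finitely many singular primes are avoided by the factors `Ψ`.
  have hreg : IsRegularLocalRing (Localization.AtPrime q) := by
    rcases hqh.lt_or_eq with h | h
    · exact hA q (Order.le_of_lt_add_one (by exact_mod_cast h))
    · by_contra hn
      exact H2 ⟨q, hq⟩ v (hv.2 ⟨q, hq⟩ (hfin.mem_toFinset.mpr ⟨by exact_mod_cast h, hn⟩)) hfq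
  have : IsRegularLocalRing S := IsRegularLocalRing.of_ringEquiv
    (IsLocalization.algEquiv q.primeCompl (Localization.AtPrime q) S).toRingEquiv
  refine isRegularLocalRing_quotient_span_singleton hfS fun h => ?_
  obtain ⟨m, hm, hmf⟩ := (algebraMap_mem_maximalIdeal_sq_iff q).mp h
  exact H1 v hv.1 q m hm hmf

end GeneralQuotient

/-! ### Dehomogenization and change of charts -/

section Dehomogenization

variable {k : Type u} [Field k] {n : ℕ}

/-- Dehomogenization `k[x_0, …, x_n] → Γ(D₊(x_i), 𝒪)`, sending `x_j` to `x_j / x_i`. -/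
def dehomAwayHom (k : Type u) [Field k] {n : ℕ} (i : Fin (n + 1)) :
    MvPolynomial (Fin (n + 1)) k →+*
      HomogeneousLocalization.Away (MvPolynomial.homogeneousSubmodule (Fin (n + 1)) k)
        (MvPolynomial.X i) :=
  MvPolynomial.eval₂Hom
    ((HomogeneousLocalization.fromZeroRingHom _ _).comp
      (algebraMap k (MvPolynomial.homogeneousSubmodule (Fin (n + 1)) k 0)))
    fun j => dehomAway ⟨MvPolynomial.X j, MvPolynomial.isHomogeneous_X k j⟩ i

/-- A monomial of degree `d` is `x_i ^ d` times its substitution `x_j ↦ x_j / x_i`. Passing to a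
ring homomorphism independent of `d` makes products of forms of different degrees tractable. -/
lemma dehomAway_eq_dehomAwayHom {d : ℕ}
    (s : MvPolynomial.homogeneousSubmodule (Fin (n + 1)) k d) (i : Fin (n + 1)) :
    dehomAway s i = dehomAwayHom k i s.1 := by
  apply HomogeneousLocalization.val_injective
  rw [val_dehomAway]
  let S := Submonoid.powers (MvPolynomial.X i : MvPolynomial (Fin (n + 1)) k)
  let L := Localization S
  let x : S := ⟨MvPolynomial.X i, 1, pow_one _⟩
  let φ : MvPolynomial (Fin (n + 1)) k →+* L := (algebraMap _ L).comp (dehomAwayHom k i)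
  have hφX (j) : φ (MvPolynomial.X j) = IsLocalization.mk' L (MvPolynomial.X j) x := by
    simp only [φ, dehomAwayHom, RingHom.comp_apply, MvPolynomial.coe_eval₂Hom,
      MvPolynomial.eval₂_X]
    rw [HomogeneousLocalization.algebraMap_apply, val_dehomAway, Localization.mk_eq_mk']
    congr 1
    ext; simp [x]
  have hφC (c : k) : φ (MvPolynomial.C c) =
      algebraMap (MvPolynomial (Fin (n + 1)) k) L (MvPolynomial.C c) := by
    simp only [φ, dehomAwayHom, RingHom.comp_apply, MvPolynomial.coe_eval₂Hom,
      MvPolynomial.eval₂_C]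
    rw [HomogeneousLocalization.algebraMap_apply]
    exact Localization.mk_one_eq_algebraMap _
  have key (α : Fin (n + 1) →₀ ℕ) (hα : α.degree = d) (c : k) :
      algebraMap (MvPolynomial (Fin (n + 1)) k) L (MvPolynomial.X i ^ d) *
        φ (MvPolynomial.monomial α c) =
        algebraMap (MvPolynomial (Fin (n + 1)) k) L (MvPolynomial.monomial α c) := by
    rw [MvPolynomial.monomial_eq, map_mul, map_mul, hφC, mul_left_comm]
    congr 1
    rw [Finsupp.prod_fintype _ _ (by simp), map_prod, map_prod, ← hα, Finsupp.degree_eq_sum,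
      ← Finset.prod_pow_eq_pow_sum, map_prod, ← Finset.prod_mul_distrib]
    refine Finset.prod_congr rfl fun j _ => ?_
    rw [map_pow, map_pow, map_pow, ← mul_pow, hφX]
    congr 1
    exact IsLocalization.mk'_spec' L (MvPolynomial.X j) x
  change _ = φ s.1
  rw [Localization.mk_eq_mk', IsLocalization.mk'_eq_iff_eq_mul, mul_comm]
  change _ = algebraMap (MvPolynomial (Fin (n + 1)) k) L (MvPolynomial.X i ^ d) * _
  conv_lhs => rw [s.1.as_sum]
  conv_rhs => rw [s.1.as_sum]
  rw [map_sum, map_sum, Finset.mul_sum]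
  refine Finset.sum_congr rfl fun α hα => (key α ?_ _).symm
  have := s.2 (MvPolynomial.mem_support_iff.mp hα)
  rw [← this, Finsupp.degree_eq_weight_one]
  rfl

/-- The ring of functions on the standard chart is the homogeneous localization. -/
def chartIso (k : Type u) [Field k] {n : ℕ} (i : Fin (n + 1)) :
    CommRingCat.of (HomogeneousLocalization.Away
      (MvPolynomial.homogeneousSubmodule (Fin (n + 1)) k) (MvPolynomial.X i)) ≅
      Γ(PP n k, (chart k i).1) :=
  Proj.basicOpenIsoAway _ _ (m := 1) (MvPolynomial.isHomogeneous_X k i) one_pos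

/-- Dehomogenization `k[x_0, …, x_n] → Γ(D₊(x_i), 𝒪)`, sending `x_j` to `x_j / x_i`. -/
def dehomHom (k : Type u) [Field k] {n : ℕ} (i : Fin (n + 1)) :
    MvPolynomial (Fin (n + 1)) k →+* Γ(PP n k, (chart k i).1) :=
  (chartIso k i).hom.hom.comp (dehomAwayHom k i)

lemma dehom_eq_chartIso {d : ℕ}
    (s : MvPolynomial.homogeneousSubmodule (Fin (n + 1)) k d) (i : Fin (n + 1)) :
    dehom s i = (chartIso k i).hom.hom (dehomAway s i) := rfl

lemma dehom_eq_dehomHom {d : ℕ}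
    (s : MvPolynomial.homogeneousSubmodule (Fin (n + 1)) k d) (i : Fin (n + 1)) :
    dehom s i = dehomHom k i s.1 := by
  rw [dehom_eq_chartIso, dehomAway_eq_dehomAwayHom]; rfl

lemma dehomHom_X_self (i : Fin (n + 1)) : dehomHom k i (MvPolynomial.X i) = 1 := by
  have : dehomAway ⟨MvPolynomial.X i, MvPolynomial.isHomogeneous_X k i⟩ i = 1 := by
    apply HomogeneousLocalization.val_injective
    rw [val_dehomAway, HomogeneousLocalization.val_one]
    simp [Localization.mk_self_mk]
  rw [dehomAway_eq_dehomAwayHom] at this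
  rw [dehomHom, RingHom.comp_apply, this, map_one]

lemma exists_dehom_eq (i : Fin (n + 1)) (a : Γ(PP n k, (chart k i).1)) :
    ∃ (d : ℕ) (s : MvPolynomial.homogeneousSubmodule (Fin (n + 1)) k d), dehom s i = a := by
  obtain ⟨d, s, hs, h⟩ := HomogeneousLocalization.Away.mk_surjective _
    (MvPolynomial.isHomogeneous_X k i) ((chartIso k i).inv.hom a)
  refine ⟨d, ⟨s, by simpa using hs⟩, ?_⟩
  have h2 : (chartIso k i).hom.hom ((chartIso k i).inv.hom a) = a := by
    rw [← RingHom.comp_apply, ← CommRingCat.hom_comp, Iso.inv_hom_id]; rfl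
  rw [← h2, ← h]
  rfl

lemma dehomHom_surjective (i : Fin (n + 1)) : Function.Surjective (dehomHom k i) := by
  intro a
  obtain ⟨d, s, hs⟩ := exists_dehom_eq i a
  exact ⟨s.1, by rw [← hs, dehom_eq_dehomHom]⟩

open MvPolynomial in
/-- The change of trivialization of `𝒪(d)` on `D₊(x_i) ∩ D₊(x_j)`. -/
lemma map_dehom_mul_pow {d : ℕ} (s : MvPolynomial.homogeneousSubmodule (Fin (n + 1)) k d)
    {i j : Fin (n + 1)} {V : (PP n k).Opens} (hi : V ≤ (chart k i).1) (hj : V ≤ (chart k j).1) :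
    ((PP n k).presheaf.map (homOfLE hj).op).hom (dehom s j) *
      ((PP n k).presheaf.map (homOfLE hi).op).hom (dehomHom k i (MvPolynomial.X j)) ^ d =
      ((PP n k).presheaf.map (homOfLE hi).op).hom (dehom s i) := by
  let 𝒜 := homogeneousSubmodule (Fin (n + 1)) k
  have hVB : V ≤ Proj.basicOpen 𝒜 (X i * X j) := by
    rw [Proj.basicOpen_mul]; exact le_inf hi hj
  let φi : HomogeneousLocalization.Away 𝒜 (X i) →+* HomogeneousLocalization.Away 𝒜 (X i * X j) :=
    HomogeneousLocalization.awayMap 𝒜 (isHomogeneous_X k j) rfl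
  let φj : HomogeneousLocalization.Away 𝒜 (X j) →+* HomogeneousLocalization.Away 𝒜 (X i * X j) :=
    HomogeneousLocalization.awayMap 𝒜 (isHomogeneous_X k i) (mul_comm (X i) (X j))
  let ρ : HomogeneousLocalization.Away 𝒜 (X i * X j) →+* Γ(PP n k, V) :=
    (Proj.awayToSection 𝒜 (X i * X j) ≫ (PP n k).presheaf.map (homOfLE hVB).op).hom
  have h1 (a) : ((PP n k).presheaf.map (homOfLE hi).op).hom ((chartIso k i).hom.hom a) =
      ρ (φi a) := by
    have := Proj.awayMap_awayToSection 𝒜 (f := X i) (isHomogeneous_X k j) rfl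
    have h := congr(($this ≫ (PP n k).presheaf.map (homOfLE hVB).op).hom a)
    rw [Category.assoc, Category.assoc, ← Functor.map_comp] at h
    exact h.symm
  have h2 (a) : ((PP n k).presheaf.map (homOfLE hj).op).hom ((chartIso k j).hom.hom a) =
      ρ (φj a) := by
    have := Proj.awayMap_awayToSection 𝒜 (f := X j) (isHomogeneous_X k i) (mul_comm (X i) (X j))
    have h := congr(($this ≫ (PP n k).presheaf.map (homOfLE hVB).op).hom a)
    rw [Category.assoc, Category.assoc, ← Functor.map_comp] at h
    exact h.symm
  have h3 : dehomHom k i (X j) = (chartIso k i).hom.hom (dehomAwayHom k i (X j)) := rfl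
  rw [h3, ← dehomAway_eq_dehomAwayHom ⟨X j, isHomogeneous_X k j⟩ i, dehom_eq_chartIso,
    dehom_eq_chartIso, h1, h1, h2, ← map_pow, ← map_mul]
  congr 1
  apply HomogeneousLocalization.val_injective
  have e1 {e : ℕ} (t : homogeneousSubmodule (Fin (n + 1)) k e) : (φi (dehomAway t i)).val =
      Localization.mk (t.1 * X j ^ e) (⟨(X i * X j) ^ e, ⟨e, rfl⟩⟩ : Submonoid.powers (X i * X j)) :=
    HomogeneousLocalization.val_awayMap_mk ..
  have e2 {e : ℕ} (t : homogeneousSubmodule (Fin (n + 1)) k e) : (φj (dehomAway t j)).val =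
      Localization.mk (t.1 * X i ^ e) (⟨(X i * X j) ^ e, ⟨e, rfl⟩⟩ : Submonoid.powers (X i * X j)) :=
    HomogeneousLocalization.val_awayMap_mk ..
  rw [HomogeneousLocalization.val_mul, HomogeneousLocalization.val_pow, e1, e1, e2,
    Localization.mk_pow, Localization.mk_mul, Localization.mk_eq_mk_iff, Localization.r_iff_exists]
  refine ⟨1, ?_⟩
  simp only [OneMemClass.coe_one, Submonoid.coe_mul, SubmonoidClass.coe_pow, one_mul]
  ring

end Dehomogenization

/-! ### Closed subschemes of affine opens as test objects -/

section ClosedSubscheme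

variable {X Y : Scheme.{u}}

lemma app_eq_zero_iff_appLE_top (f : X ⟶ Y) {U : Y.Opens} (h : ⊤ ≤ f ⁻¹ᵁ U) (z : Γ(Y, U)) :
    (f.app U).hom z = 0 ↔ (f.appLE U ⊤ h).hom z = 0 := by
  constructor
  · intro hz
    rw [Scheme.Hom.appLE, CommRingCat.hom_comp, RingHom.comp_apply, hz, map_zero]
  · intro hz
    rw [f.app_eq_appLE, ← f.appLE_map h (homOfLE le_top).op, CommRingCat.hom_comp,
      RingHom.comp_apply, hz, map_zero]

/-- The closed subscheme of an affine open `W` of `X` cut out by an ideal, as a scheme over `X`. -/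
def closedSubscheme {W : X.Opens} (hW : IsAffineOpen W) (𝔞 : Ideal Γ(X, W)) :
    Spec (.of (Γ(X, W) ⧸ 𝔞)) ⟶ X :=
  Spec.map (CommRingCat.ofHom (Ideal.Quotient.mk 𝔞)) ≫ hW.fromSpec

lemma top_le_closedSubscheme_preimage {W : X.Opens} (hW : IsAffineOpen W)
    (𝔞 : Ideal Γ(X, W)) : ⊤ ≤ closedSubscheme hW 𝔞 ⁻¹ᵁ W := by
  intro x _
  have : hW.fromSpec (Spec.map (CommRingCat.ofHom (Ideal.Quotient.mk 𝔞)) x) ∈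
    Set.range hW.fromSpec := ⟨_, rfl⟩
  rw [hW.range_fromSpec] at this
  exact this

lemma closedSubscheme_appLE {W : X.Opens} (hW : IsAffineOpen W) (𝔞 : Ideal Γ(X, W)) :
    (closedSubscheme hW 𝔞).appLE W ⊤ (top_le_closedSubscheme_preimage hW 𝔞) =
      CommRingCat.ofHom (Ideal.Quotient.mk 𝔞) ≫ (Scheme.ΓSpecIso _).inv := by
  have : ⊤ ≤ Spec.map (CommRingCat.ofHom (Ideal.Quotient.mk 𝔞)) ⁻¹ᵁ (hW.fromSpec ⁻¹ᵁ W) :=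
    top_le_closedSubscheme_preimage hW 𝔞
  rw [Scheme.ΓSpecIso_inv_naturality]
  trans hW.fromSpec.app W ≫ (Spec.map (CommRingCat.ofHom (Ideal.Quotient.mk 𝔞))).appLE _ ⊤ this
  · exact Scheme.Hom.comp_appLE _ _ _ _ _
  · rw [hW.fromSpec_app_self, Category.assoc, Scheme.Hom.map_appLE, Scheme.Hom.appTop,
      Scheme.Hom.app_eq_appLE]
    rfl

lemma closedSubscheme_appLE_eq_zero_iff {W : X.Opens} (hW : IsAffineOpen W) (𝔞 : Ideal Γ(X, W))
    (z : Γ(X, W)) :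
    ((closedSubscheme hW 𝔞).appLE W ⊤ (top_le_closedSubscheme_preimage hW 𝔞)).hom z = 0 ↔
      z ∈ 𝔞 := by
  have hinj : Function.Injective (Scheme.ΓSpecIso (.of (Γ(X, W) ⧸ 𝔞))).inv.hom :=
    (Scheme.ΓSpecIso (.of (Γ(X, W) ⧸ 𝔞))).symm.commRingCatIsoToRingEquiv.injective
  rw [closedSubscheme_appLE, CommRingCat.hom_comp, RingHom.comp_apply]
  exact (map_eq_zero_iff _ hinj).trans Ideal.Quotient.eq_zero_iff_mem

/-- Bounds an ideal sheaf on `W` by testing it against `V(𝔞)`: it suffices that the sheaf lie in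
this kernel, although `V(𝔞)` need not be closed in `X`. -/
lemma ideal_ker_closedSubscheme_le (W : X.affineOpens) (𝔞 : Ideal Γ(X, W.1)) :
    (closedSubscheme W.2 𝔞).ker.ideal W ≤ 𝔞 := fun z hz =>
  (closedSubscheme_appLE_eq_zero_iff W.2 𝔞 z).mp ((app_eq_zero_iff_appLE_top _
    (top_le_closedSubscheme_preimage W.2 𝔞) z).mp (Scheme.Hom.ideal_ker_le _ W hz))

end ClosedSubscheme

/-! ### Local equations of a hypersurface -/

section Hypersurface

open MvPolynomial

variable {k : Type u} [Field k] {n : ℕ}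

lemma iSup_chart : ⨆ i, (chart k (n := n) i).1 = ⊤ := by
  refine Proj.iSup_basicOpen_eq_top' (homogeneousSubmodule (Fin (n + 1)) k)
    (fun i => (X i : MvPolynomial (Fin (n + 1)) k)) (fun i => ⟨1, isHomogeneous_X k i⟩) ?_
  rw [_root_.eq_top_iff]
  intro p _
  induction p using MvPolynomial.induction_on with
  | C a =>
    let c : homogeneousSubmodule (Fin (n + 1)) k 0 := ⟨C a, isHomogeneous_C _ a⟩
    exact Subalgebra.algebraMap_mem (Algebra.adjoin (homogeneousSubmodule (Fin (n + 1)) k 0) _) c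
  | add p q hp hq => exact add_mem (hp trivial) (hq trivial)
  | mul_X p i hp => exact mul_mem (hp trivial) (Algebra.subset_adjoin ⟨i, rfl⟩)

lemma exists_mem_chart (x : PP n k) : ∃ i, x ∈ (chart k i).1 :=
  TopologicalSpace.Opens.mem_iSup.mp (iSup_chart (k := k) (n := n) ▸ trivial)

lemma isUnit_map_dehomHom_X {i j : Fin (n + 1)} {V : (PP n k).Opens} (hi : V ≤ (chart k i).1)
    (hj : V ≤ (chart k j).1) :
    IsUnit (((PP n k).presheaf.map (homOfLE hi).op).hom (dehomHom k i (X j))) := by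
  have := map_dehom_mul_pow ⟨X i, isHomogeneous_X k i⟩ hi hj
  rw [dehom_eq_dehomHom _ i, dehomHom_X_self, map_one, pow_one] at this
  exact .of_mul_eq_one_right _ this

variable {d : ℕ} (s : homogeneousSubmodule (Fin (n + 1)) k d)

variable {s} in
-- On overlaps the trivializations of `s` differ by a unit, so vanishing on the chart containing the
-- image of `g` gives vanishing on all charts.
lemma mem_globalSections_ker {T : Scheme.{u}} (g : T ⟶ PP n k) [QuasiCompact g]
    {i : Fin (n + 1)} (hi : ⊤ ≤ g ⁻¹ᵁ (chart k i).1)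
    (h : (g.appLE (chart k i).1 ⊤ hi).hom (dehom s i) = 0) : s ∈ globalSections g.ker d := by
  intro j
  rw [Scheme.Hom.ker_apply, RingHom.mem_ker]
  have e : g ⁻¹ᵁ (chart k j).1 ≤ g ⁻¹ᵁ ((chart k i).1 ⊓ (chart k j).1) :=
    fun x hx => ⟨hi trivial, hx⟩
  have h1 := congr((g.appLE _ _ e).hom $(map_dehom_mul_pow s
    (inf_le_left : (chart k i).1 ⊓ (chart k j).1 ≤ _) inf_le_right))
  rw [map_mul, map_pow, ← RingHom.comp_apply, ← CommRingCat.hom_comp, g.map_appLE,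
    ← g.app_eq_appLE] at h1
  have h2 : (g.appLE _ _ e).hom (((PP n k).presheaf.map (homOfLE inf_le_left).op).hom
      (dehom s i)) = 0 := by
    rw [← RingHom.comp_apply, ← CommRingCat.hom_comp, g.map_appLE,
      ← g.appLE_map hi (homOfLE le_top).op, CommRingCat.hom_comp, RingHom.comp_apply, h, map_zero]
  rw [h2] at h1
  exact (((isUnit_map_dehomHom_X inf_le_left inf_le_right).map (g.appLE _ _ e).hom).pow
    d).mul_left_eq_zero.mp h1

lemma mem_globalSections_of_le {I J : (PP n k).IdealSheafData} (h : I ≤ J)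
    (hs : s ∈ globalSections I d) : s ∈ globalSections J d := fun i => h _ (hs i)

/-- An arbitrary infimum of ideal sheaves need not be computed chart by chart, but a finite one is.
The finite infimum `L` of the kernels attached to the pieces `{s = 0} ∩ D₊(x_i)` has `s` as a
section and lies below every competitor. -/
lemma mem_globalSections_hypersurfaceIdeal : s ∈ globalSections (hypersurfaceIdeal s) d := by
  let L : (PP n k).IdealSheafData :=
    ⨅ i, (closedSubscheme (chart k i).2 (Ideal.span {dehom s i})).ker
  have hL : L ≤ hypersurfaceIdeal s := by
    refine le_sInf fun J hJ => Scheme.IdealSheafData.le_of_iSup_eq_top _ iSup_chart fun i => ?_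
    refine ((iInf_le _ i : L ≤ _) (chart k i)).trans ((ideal_ker_closedSubscheme_le _ _).trans ?_)
    rw [Ideal.span_singleton_le_iff_mem]
    exact hJ i
  refine mem_globalSections_of_le s hL fun j => ?_
  rw [Scheme.IdealSheafData.ideal_iInf, iInf_apply, Submodule.mem_iInf]
  exact fun i => mem_globalSections_ker _ (top_le_closedSubscheme_preimage _ _)
    ((closedSubscheme_appLE_eq_zero_iff _ _ _).mpr (Ideal.mem_span_singleton_self _)) j

lemma hypersurfaceIdeal_le_iff {J : (PP n k).IdealSheafData} :
    hypersurfaceIdeal s ≤ J ↔ s ∈ globalSections J d :=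
  ⟨fun h => mem_globalSections_of_le s h (mem_globalSections_hypersurfaceIdeal s),
    fun h => sInf_le h⟩

/-- The equation of `X ∩ H` on an affine open subset of `X` mapping to a standard chart. -/
lemma ideal_comap_hypersurfaceIdeal {X : Scheme.{u}} (f : X ⟶ PP n k) (i : Fin (n + 1))
    (W : X.affineOpens) (hW : W.1 ≤ f ⁻¹ᵁ (chart k i).1) :
    ((hypersurfaceIdeal s).comap f).ideal W =
      Ideal.span {(f.appLE (chart k i).1 W.1 hW).hom (dehom s i)} := by
  set z := (f.appLE (chart k i).1 W.1 hW).hom (dehom s i) with hz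
  apply le_antisymm
  · let g := closedSubscheme W.2 (Ideal.span {z})
    -- By adjunction this asks that `s` be a section of the kernel of `V(z) → ℙⁿ`, where its
    -- pullback vanishes by construction.
    suffices (hypersurfaceIdeal s).comap f ≤ g.ker from
      (this W).trans (ideal_ker_closedSubscheme_le W _)
    rw [← Scheme.IdealSheafData.le_map_iff_comap_le, Scheme.IdealSheafData.map_ker,
      hypersurfaceIdeal_le_iff]
    have hg : ⊤ ≤ g ⁻¹ᵁ W.1 := top_le_closedSubscheme_preimage W.2 _
    refine mem_globalSections_ker (g ≫ f) (i := i) (fun x hx => hW (hg hx)) ?_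
    rw [← Scheme.Hom.appLE_comp_appLE _ _ _ W.1 ⊤ hW hg, CommRingCat.hom_comp, RingHom.comp_apply]
    exact (closedSubscheme_appLE_eq_zero_iff _ _ _).mpr (Ideal.mem_span_singleton_self _)
  · rw [Ideal.span_singleton_le_iff_mem]
    set K := (hypersurfaceIdeal s).comap f
    have h1 : hypersurfaceIdeal s ≤ (K.subschemeι ≫ f).ker :=
      (hypersurfaceIdeal s).le_map_comap f
    have h2 := Scheme.Hom.ideal_ker_le _ _
      (((hypersurfaceIdeal_le_iff s).mp h1) i)
    rw [← K.ker_subschemeι_app, RingHom.mem_ker, hz]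
    rw [RingHom.mem_ker] at h2
    have e : K.subschemeι ⁻¹ᵁ W.1 ≤ (K.subschemeι ≫ f) ⁻¹ᵁ (chart k i).1 := fun x hx => hW hx
    have h3 : f.appLE (chart k i).1 W.1 hW ≫ K.subschemeι.app W.1 =
        (K.subschemeι ≫ f).app (chart k i).1 ≫ K.subscheme.presheaf.map (homOfLE e).op := by
      rw [Scheme.Hom.app_eq_appLE, Scheme.Hom.app_eq_appLE, Scheme.Hom.appLE_comp_appLE,
        Scheme.Hom.appLE_map]
    rw [← RingHom.comp_apply, ← CommRingCat.hom_comp, h3, CommRingCat.hom_comp,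
      RingHom.comp_apply, h2, map_zero]

end Hypersurface

/-! ### Local rings of `X ∩ H` -/

section Stalk

open IsLocalRing

/-- Taking kernels commutes with localization, in the form needed for stalk maps of closed
immersions: locality of `ψ` lifts the unit `β (φ m)` to a unit `α m`. -/
lemma ker_eq_map_ker {A B S T : Type*} [CommRing A] [CommRing B] [CommRing S] [CommRing T]
    {α : A →+* S} {β : B →+* T} {φ : A →+* B} {ψ : S →+* T} [IsLocalHom ψ]
    (hα : ∀ y, ∃ a b, IsUnit (α b) ∧ y * α b = α a)
    (hβ : ∀ b, β b = 0 → ∃ m, IsUnit (β m) ∧ m * b = 0)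
    (hφ : Function.Surjective φ) (h : ∀ x, ψ (α x) = β (φ x)) :
    RingHom.ker ψ = (RingHom.ker φ).map α := by
  apply le_antisymm
  · intro y hy
    obtain ⟨a, b, hb, hab⟩ := hα y
    have h1 : β (φ a) = 0 := by
      rw [← h, ← hab, map_mul, (RingHom.mem_ker).mp hy, zero_mul]
    obtain ⟨m, hm, hma⟩ := hβ _ h1
    obtain ⟨m, rfl⟩ := hφ m
    rw [← h] at hm
    have h2 : m * a ∈ RingHom.ker φ := by rw [RingHom.mem_ker, map_mul, hma]
    have h3 := Ideal.mem_map_of_mem α h2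
    rwa [map_mul, ← hab, Ideal.unit_mul_mem_iff_mem _ (isUnit_of_map_unit ψ _ hm),
      Ideal.mul_unit_mem_iff_mem _ hb] at h3
  · rw [Ideal.map_le_iff_le_comap]
    intro x hx
    rw [Ideal.mem_comap, RingHom.mem_ker, h, (RingHom.mem_ker).mp hx, map_zero]

lemma exists_mul_germ_eq {X : Scheme.{u}} {U : X.Opens} (hU : IsAffineOpen U) {x : X} (hx : x ∈ U)
    (y : X.presheaf.stalk x) : ∃ a b : Γ(X, U), IsUnit ((X.presheaf.germ U x hx).hom b) ∧
      y * (X.presheaf.germ U x hx).hom b = (X.presheaf.germ U x hx).hom a := by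
  let := X.presheaf.algebra_section_stalk ⟨x, hx⟩
  have := hU.isLocalization_stalk ⟨x, hx⟩
  obtain ⟨⟨a, b⟩, hab⟩ := IsLocalization.surj (hU.primeIdealOf ⟨x, hx⟩).asIdeal.primeCompl y
  exact ⟨a, b, IsLocalization.map_units _ b, hab⟩

lemma exists_mul_eq_zero_of_germ_eq_zero {X : Scheme.{u}} {U : X.Opens} (hU : IsAffineOpen U)
    {x : X} (hx : x ∈ U) (b : Γ(X, U)) (hb : (X.presheaf.germ U x hx).hom b = 0) :
    ∃ m : Γ(X, U), IsUnit ((X.presheaf.germ U x hx).hom m) ∧ m * b = 0 := by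
  let := X.presheaf.algebra_section_stalk ⟨x, hx⟩
  have := hU.isLocalization_stalk ⟨x, hx⟩
  obtain ⟨m, hm⟩ := (IsLocalization.map_eq_zero_iff
    (hU.primeIdealOf ⟨x, hx⟩).asIdeal.primeCompl (X.presheaf.stalk x) b).mp hb
  exact ⟨m, IsLocalization.map_units _ m, hm⟩

lemma ker_stalkMap_subschemeι {X : Scheme.{u}} (K : X.IdealSheafData) (y : K.subscheme)
    (W : X.affineOpens) (hy : K.subschemeι y ∈ W.1) :
    RingHom.ker (K.subschemeι.stalkMap y).hom =
      (K.ideal W).map (X.presheaf.germ W.1 _ hy).hom := by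
  rw [← K.ker_subschemeι_app]
  exact ker_eq_map_ker (exists_mul_germ_eq W.2 hy)
    (exists_mul_eq_zero_of_germ_eq_zero (W.2.preimage K.subschemeι) (x := y) hy)
    (K.subschemeι_app_surjective W) (K.subschemeι.germ_stalkMap_apply W.1 y hy)

/-- The local rings of `X ∩ H`. -/
lemma exists_stalk_interHypersurface_equiv {k : Type u} [Field k] {n d : ℕ}
    (s : MvPolynomial.homogeneousSubmodule (Fin (n + 1)) k d) {X : Scheme.{u}} (f : X ⟶ PP n k)
    (y : (interHypersurface f s : Scheme.{u})) :
    ∃ x : X, ∀ (i : Fin (n + 1)) (W : X.affineOpens) (hW : W.1 ≤ f ⁻¹ᵁ (chart k i).1)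
      (hx : x ∈ W.1), (X.presheaf.germ W.1 x hx).hom
        ((f.appLE (chart k i).1 W.1 hW).hom (dehom s i)) ∈ maximalIdeal (X.presheaf.stalk x) ∧
      Nonempty ((X.presheaf.stalk x ⧸ Ideal.span {(X.presheaf.germ W.1 x hx).hom
        ((f.appLE (chart k i).1 W.1 hW).hom (dehom s i))}) ≃+*
        (interHypersurface f s).presheaf.stalk y) := by
  let J := hypersurfaceIdeal s
  let K := J.comap f
  let e : (interHypersurface f s) ≅ K.subscheme := (J.comapIso f).symm
  let y' : K.subscheme := e.hom y
  refine ⟨K.subschemeι y', fun i W hW hx => ?_⟩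
  have hker := ker_stalkMap_subschemeι K y' W hx
  rw [ideal_comap_hypersurfaceIdeal s f i W hW, Ideal.map_span, Set.image_singleton] at hker
  have hsurj : Function.Surjective (K.subschemeι.stalkMap y').hom :=
    K.subschemeι.stalkMap_surjective y'
  constructor
  · have h1 : (X.presheaf.germ W.1 _ hx).hom
        ((f.appLE (chart k i).1 W.1 hW).hom (dehom s i)) ∈
        RingHom.ker (K.subschemeι.stalkMap y').hom := by
      rw [hker]; exact Ideal.mem_span_singleton_self _
    rw [mem_maximalIdeal, mem_nonunits_iff]
    intro hu
    have := hu.map (K.subschemeι.stalkMap y').hom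
    rw [(RingHom.mem_ker).mp h1] at this
    exact not_isUnit_zero this
  · exact ⟨(Ideal.quotEquivOfEq hker.symm).trans
      ((RingHom.quotientKerEquivOfSurjective hsurj).trans
        (asIso (e.hom.stalkMap y)).commRingCatIsoToRingEquiv)⟩

end Stalk

/-! ### Forms vanishing along a closed subscheme -/

section GlobalSections

open MvPolynomial

variable {k : Type u} [Field k] {n : ℕ}

lemma mem_globalSections_of_eq_mul {I : (PP n k).IdealSheafData} {d e : ℕ}
    {s : homogeneousSubmodule (Fin (n + 1)) k d} {g : homogeneousSubmodule (Fin (n + 1)) k e}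
    (hg : g ∈ globalSections I e) {h : MvPolynomial (Fin (n + 1)) k} (hs : s.1 = g.1 * h) :
    s ∈ globalSections I d := fun i => by
  rw [dehom_eq_dehomHom, hs, map_mul, ← dehom_eq_dehomHom]
  exact Ideal.mul_mem_right _ _ (hg i)

lemma basicOpen_dehomHom_X_le (j m : Fin (n + 1)) :
    (PP n k).basicOpen (dehomHom k j (X m)) ≤ (chart k m).1 := by
  intro x hx
  have hxj : x ∈ (chart k j).1 := (PP n k).basicOpen_le _ hx
  rw [Scheme.mem_basicOpen _ _ _ hxj] at hx
  let 𝒜 := homogeneousSubmodule (Fin (n + 1)) k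
  have hprime : x.asHomogeneousIdeal.toIdeal.IsPrime := x.isPrime
  let t := dehomAway ⟨X m, isHomogeneous_X k m⟩ j
  have ht : dehomHom k j (X m) = (chartIso k j).hom.hom t := by
    rw [← dehom_eq_chartIso, dehom_eq_dehomHom]
  have h1 := congr(($(ProjectiveSpectrum.Proj.awayToSection_germ 𝒜 (X j) x hxj)).hom t)
  let φ := HomogeneousLocalization.mapId 𝒜 (P := Submonoid.powers (X j))
    (Q := x.asHomogeneousIdeal.toIdeal.primeCompl) (Submonoid.powers_le.mpr hxj)
  have h2 : IsUnit ((Proj.stalkIso' 𝒜 x).symm (φ t)) := by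
    rw [ht] at hx
    have hx' : IsUnit ((ProjectiveSpectrum.Proj.awayToSection 𝒜 (X j) ≫
      (ProjectiveSpectrum.Proj.structureSheaf 𝒜).presheaf.germ _ x hxj).hom t) := hx
    rw [h1] at hx'
    exact hx'
  have h3 : IsUnit (φ t) := by simpa using h2.map (Proj.stalkIso' 𝒜 x)
  have h4 : IsUnit (φ t).val :=
    h3.map (algebraMap _ (Localization x.asHomogeneousIdeal.toIdeal.primeCompl))
  have h5 : (φ t).val = Localization.mk (X m) (⟨X j ^ 1, Submonoid.powers_le.mpr hxj ⟨1, rfl⟩⟩ :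
    x.asHomogeneousIdeal.toIdeal.primeCompl) := rfl
  rw [h5, Localization.mk_eq_mk', IsLocalization.AtPrime.isUnit_mk'_iff] at h4
  exact h4

/-- Where `x_m ≠ 0` on chart `j`, the trivializations of `s` on the two charts agree up to a unit.
Extending membership to all of chart `j` costs a power of `x_m / x_j`. -/
lemma exists_pow_mul_mem_ideal (I : (PP n k).IdealSheafData) {d : ℕ}
    (s : homogeneousSubmodule (Fin (n + 1)) k d) (m j : Fin (n + 1))
    (hs : dehom s m ∈ I.ideal (chart k m)) :
    ∃ r, dehomHom k j (X m) ^ r * dehom s j ∈ I.ideal (chart k j) := by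
  set t := dehomHom k j (X m)
  let B : (PP n k).affineOpens := (PP n k).affineBasicOpen t
  have hBj : B.1 ≤ (chart k j).1 := (PP n k).basicOpen_le t
  have hBm : B.1 ≤ (chart k m).1 := basicOpen_dehomHom_X_le j m
  have h1 : ((PP n k).presheaf.map (homOfLE hBj).op).hom (dehom s j) ∈ I.ideal B := by
    rw [← map_dehom_mul_pow s hBj hBm]
    exact Ideal.mul_mem_right _ _ (I.ideal_le_comap_ideal (U := B) (V := chart k m) hBm hs)
  rw [← I.map_ideal_basicOpen] at h1
  have := (chart k j).2.isLocalization_basicOpen t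
  obtain ⟨⟨s', ⟨_, r, rfl⟩⟩, hs'⟩ :=
    (IsLocalization.mem_map_algebraMap_iff (.powers t) Γ(PP n k, (PP n k).basicOpen t)).mp h1
  have h2 : algebraMap _ Γ(PP n k, (PP n k).basicOpen t) (dehom s j * t ^ r) =
      algebraMap _ Γ(PP n k, (PP n k).basicOpen t) s'.1 := by
    rw [map_mul]; exact hs'
  obtain ⟨⟨_, r', rfl⟩, h3⟩ := (IsLocalization.eq_iff_exists (.powers t) _).mp h2
  refine ⟨r' + r, ?_⟩
  have h4 : t ^ (r' + r) * dehom s j = t ^ r' * s'.1 := by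
    rw [← h3, pow_add]; ring
  rw [h4]
  exact Ideal.mul_mem_left _ _ s'.2

/-- Forms vanishing along a closed subscheme of projective space generate its ideal up to
twisting: a point outside the subscheme is separated from it by such a form. -/
lemma exists_globalSections_mem_basicOpen (I : (PP n k).IdealSheafData) (x : PP n k)
    (hx : x ∉ I.support) : ∃ (m : Fin (n + 1)) (e : ℕ)
      (g : homogeneousSubmodule (Fin (n + 1)) k e), g ∈ globalSections I e ∧
      x ∈ (PP n k).basicOpen (dehom g m) := by
  obtain ⟨m, hm⟩ := exists_mem_chart x
  rw [Scheme.IdealSheafData.mem_support_iff_of_mem (U := chart k m) hm,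
    Scheme.mem_zeroLocus_iff] at hx
  push Not at hx
  obtain ⟨a, haI, hxa⟩ := hx
  obtain ⟨e, g, rfl⟩ := exists_dehom_eq m a
  choose r hr using fun j => exists_pow_mul_mem_ideal I g m j haI
  -- One exponent serves all charts, and the factor `x_m ^ R` becomes `1` on chart `m`.
  let R := Finset.univ.sup r
  let g' : homogeneousSubmodule (Fin (n + 1)) k (e + R) :=
    ⟨g.1 * X m ^ R, IsHomogeneous.mul g.2 (by simpa using (isHomogeneous_X k m).pow R)⟩
  refine ⟨m, e + R, g', fun j => ?_, ?_⟩
  · rw [dehom_eq_dehomHom, map_mul, map_pow, ← dehom_eq_dehomHom]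
    have : r j ≤ R := Finset.le_sup (Finset.mem_univ j)
    rw [← Nat.sub_add_cancel this, pow_add, mul_comm, mul_assoc]
    exact Ideal.mul_mem_left _ _ (hr j)
  · have : dehom g' m = dehom g m := by
      rw [dehom_eq_dehomHom, map_mul, map_pow, dehomHom_X_self, one_pow, mul_one,
        ← dehom_eq_dehomHom]
    rwa [this]

end GlobalSections

/-! ### Separation of tangent vectors -/

section Jets

open Algebra

/-- Multiples of a unit by functions that generate an unramified algebra separate
tangent vectors. -/
lemma eq_zero_of_jet_eq_zero {k B A K σ : Type*} [CommRing k] [CommRing B] [CommRing A] [Field K]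
    [Algebra k B] [Algebra k A] [Algebra B A] [IsScalarTower k B A] [Algebra A K] [Algebra k K]
    [IsScalarTower k A K] [FormallyUnramified B A] {t : σ → B}
    (ht : Algebra.adjoin k (Set.range t) = ⊤) {G : A} (hG : IsUnit G) (c : K)
    (D : Derivation k A K) (h0 : c * algebraMap A K G + D G = 0)
    (h : ∀ j, c * algebraMap A K (G * algebraMap B A (t j)) + D (G * algebraMap B A (t j)) = 0) :
    c = 0 ∧ D = 0 := by
  have hGK : algebraMap A K G ≠ 0 := (hG.map (algebraMap A K)).ne_zero
  have hDt (j : σ) : D (algebraMap B A (t j)) = 0 := by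
    have h1 := h j
    rw [D.leibniz, map_mul, Algebra.smul_def, Algebra.smul_def] at h1
    have h2 : algebraMap A K G * D (algebraMap B A (t j)) = 0 := by
      linear_combination h1 - algebraMap A K (algebraMap B A (t j)) * h0
    exact (mul_eq_zero.mp h2).resolve_left hGK
  have hDB (b : B) : D (algebraMap B A b) = 0 := by
    have hb : b ∈ Algebra.adjoin k (Set.range t) := ht ▸ trivial
    induction hb using Algebra.adjoin_induction with
    | mem x hx => obtain ⟨j, rfl⟩ := hx; exact hDt j
    | algebraMap r => rw [← IsScalarTower.algebraMap_apply, D.map_algebraMap]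
    | add x y _ _ hx hy => rw [map_add, map_add, hx, hy, add_zero]
    | mul x y _ _ hx hy => rw [map_mul, D.leibniz, hx, hy, smul_zero, smul_zero, add_zero]
  let : Algebra B K := ((algebraMap A K).comp (algebraMap B A)).toAlgebra
  have : IsScalarTower B A K := .of_algebraMap_eq fun _ => rfl
  -- `D` kills the image of `B`, so it is `B`-linear and factors through `Ω[A⁄B] = 0`.
  let E : Derivation B A K :=
    { toFun := D
      map_add' := D.map_add
      map_smul' := fun b x => by
        rw [Algebra.smul_def, D.leibniz, hDB, smul_zero, add_zero, algebraMap_smul]; rfl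
      map_one_eq_zero' := D.map_one_eq_zero
      leibniz' := D.leibniz }
  have hD0 : D = 0 := by
    ext x
    change E x = 0
    rw [← E.liftKaehlerDifferential_comp_D, Subsingleton.elim (KaehlerDifferential.D B A x) 0,
      map_zero]
  refine ⟨?_, hD0⟩
  rw [hD0, Derivation.zero_apply, add_zero] at h0
  exact (mul_eq_zero.mp h0).resolve_right hGK

end Jets

/-! ### The Bertini statement on one affine piece -/

section LocalBertini

open MvPolynomial IsLocalRing

variable {k : Type u} [Field k] {n : ℕ}

lemma isRegularLocalRing_localization_of_isRa {a : ℕ} {X : Scheme.{u}} (hX : IsRa a X)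
    (W : X.affineOpens) (q : Ideal Γ(X, W.1)) [hq : q.IsPrime] (h : q.height ≤ a) :
    IsRegularLocalRing (Localization.AtPrime q) := by
  have hx : W.2.fromSpec ⟨q, hq⟩ ∈ W.1 := by
    have : W.2.fromSpec ⟨q, hq⟩ ∈ Set.range W.2.fromSpec := ⟨_, rfl⟩
    rwa [W.2.range_fromSpec] at this
  let := X.presheaf.algebra_section_stalk ⟨_, hx⟩
  have hloc : IsLocalization.AtPrime (X.presheaf.stalk (W.2.fromSpec ⟨q, hq⟩)) q :=
    W.2.isLocalization_stalk' ⟨q, hq⟩ hx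
  have := hX (W.2.fromSpec ⟨q, hq⟩) (by
    rw [IsLocalization.AtPrime.ringKrullDim_eq_height q]; exact_mod_cast h)
  exact IsRegularLocalRing.of_ringEquiv (IsLocalization.algEquiv q.primeCompl
    (X.presheaf.stalk (W.2.fromSpec ⟨q, hq⟩)) (Localization.AtPrime q)).toRingEquiv

/-- Separation holds for a basis of the sections because `g` is a unit on `W`, the coordinates
generate the functions on the chart, and an immersion is unramified. -/
lemma exists_general_isRegularLocalRing_stalk_quotient {X : Scheme.{u}} (f : X ⟶ PP n k)
    [IsImmersion f] {a : ℕ} (hX : IsRa a X) (I : (PP n k).IdealSheafData) (m : Fin (n + 1))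
    (W : X.affineOpens) (hW : W.1 ≤ f ⁻¹ᵁ (chart k m).1) {e : ℕ}
    {g : homogeneousSubmodule (Fin (n + 1)) k e} (hg : g ∈ globalSections I e)
    (hu : IsUnit ((f.appLE (chart k m).1 W.1 hW).hom (dehom g m))) {d : ℕ} (hd : e < d)
    {N : ℕ} (b : Module.Basis (Fin N) k (globalSections I d)) :
    ∃ Φ : MvPolynomial (Fin N) k, Φ ≠ 0 ∧ ∀ s : globalSections I d, eval (b.repr s) Φ ≠ 0 →
      ∀ (x : X) (hx : x ∈ W.1),
        (X.presheaf.germ W.1 x hx).hom ((f.appLE (chart k m).1 W.1 hW).hom (dehom s.1 m)) ∈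
          maximalIdeal (X.presheaf.stalk x) →
        ringKrullDim (X.presheaf.stalk x ⧸ Ideal.span {(X.presheaf.germ W.1 x hx).hom
          ((f.appLE (chart k m).1 W.1 hW).hom (dehom s.1 m))}) ≤ a →
        IsRegularLocalRing (X.presheaf.stalk x ⧸ Ideal.span {(X.presheaf.germ W.1 x hx).hom
          ((f.appLE (chart k m).1 W.1 hW).hom (dehom s.1 m))}) := by
  let φ := (f.appLE (chart k m).1 W.1 hW).hom
  let : Algebra k Γ(PP n k, (chart k m).1) := ((dehomHom k m).comp C).toAlgebra
  let : Algebra Γ(PP n k, (chart k m).1) Γ(X, W.1) := φ.toAlgebra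
  let : Algebra k Γ(X, W.1) := (φ.comp ((dehomHom k m).comp C)).toAlgebra
  have : IsScalarTower k Γ(PP n k, (chart k m).1) Γ(X, W.1) := .of_algebraMap_eq fun _ => rfl
  let ψ : MvPolynomial (Fin (n + 1)) k →ₐ[k] Γ(PP n k, (chart k m).1) :=
    { dehomHom k m with commutes' := fun _ => rfl }
  have hψ : Function.Surjective ψ := dehomHom_surjective m
  have : Algebra.FiniteType k Γ(PP n k, (chart k m).1) := .of_surjective ψ hψ
  have : Algebra.FiniteType Γ(PP n k, (chart k m).1) Γ(X, W.1) :=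
    f.finiteType_appLE (chart k m).2 W.2 hW
  have : Algebra.FiniteType k Γ(X, W.1) := .trans inferInstance
    (inferInstance : Algebra.FiniteType Γ(PP n k, (chart k m).1) Γ(X, W.1))
  have : Algebra.FormallyUnramified Γ(PP n k, (chart k m).1) Γ(X, W.1) :=
    f.formallyUnramified_appLE (chart k m).2 W.2 hW
  let θ : globalSections I d →ₗ[k] Γ(X, W.1) :=
    ((IsScalarTower.toAlgHom k Γ(PP n k, (chart k m).1) Γ(X, W.1)).comp ψ).toLinearMap.comp
      ((Submodule.subtype _).comp (Submodule.subtype _))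
  have hθ (s : globalSections I d) : θ s = φ (dehom s.1 m) := by
    rw [dehom_eq_dehomHom]; rfl
  have hadj : Algebra.adjoin k (Set.range fun j => ψ (MvPolynomial.X j)) = ⊤ := by
    have h1 := congr(Subalgebra.map ψ $(MvPolynomial.adjoin_range_X (R := k)
      (σ := Fin (n + 1))))
    rw [AlgHom.map_adjoin, ← Set.range_comp, Algebra.map_top,
      (AlgHom.range_eq_top ψ).mpr hψ] at h1
    exact h1
  have hjets (p : Ideal Γ(X, W.1)) [p.IsPrime] (c : p.ResidueField)
      (D : Derivation k Γ(X, W.1) p.ResidueField)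
      (hcD : ∀ j, c * algebraMap _ _ (θ (b j)) + D (θ (b j)) = 0) : c = 0 ∧ D = 0 := by
    let L : Γ(X, W.1) →ₗ[k] p.ResidueField :=
      (LinearMap.mulLeft k c).comp
        (IsScalarTower.toAlgHom k Γ(X, W.1) p.ResidueField).toLinearMap + D.toLinearMap
    have hL : L.comp θ = 0 := b.ext hcD
    have hall {s : homogeneousSubmodule (Fin (n + 1)) k d} {h : MvPolynomial (Fin (n + 1)) k}
        (hs : s.1 = g.1 * h) : c * algebraMap _ _ (φ (dehom g m) * φ (ψ h)) +
          D (φ (dehom g m) * φ (ψ h)) = 0 := by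
      have h1 := LinearMap.congr_fun hL ⟨s, mem_globalSections_of_eq_mul hg hs⟩
      have h2 : θ ⟨s, mem_globalSections_of_eq_mul hg hs⟩ = φ (dehom g m) * φ (ψ h) := by
        rw [hθ, dehom_eq_dehomHom, hs, map_mul, map_mul, ← dehom_eq_dehomHom]; rfl
      rw [LinearMap.comp_apply, h2] at h1
      exact h1
    have hXm : ψ (MvPolynomial.X m) = 1 := dehomHom_X_self m
    -- One degree is kept for `x_j`, hence `e < d`. On chart `m` the power of `x_m` is `1`, so `j =
    -- m` gives `g` itself.
    have hhom (j : Fin (n + 1)) : (g.1 * (MvPolynomial.X m ^ (d - e - 1) * MvPolynomial.X j) :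
        MvPolynomial (Fin (n + 1)) k).IsHomogeneous d := by
      have := IsHomogeneous.mul g.2 ((((isHomogeneous_X k m).pow (d - e - 1))).mul
        (isHomogeneous_X k j))
      convert this using 1
      omega
    have hj (j : Fin (n + 1)) := hall (s := ⟨_, hhom j⟩) rfl
    simp only [map_mul ψ, map_pow ψ, hXm, one_pow, one_mul] at hj
    refine eq_zero_of_jet_eq_zero hadj hu c D ?_ hj
    have := hj m
    rwa [hXm, map_one, mul_one] at this
  obtain ⟨Φ, hΦ, H⟩ := exists_general_isRegularLocalRing_quotient (fun j => θ (b j)) (k := k)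
    hjets a fun q _ hq => isRegularLocalRing_localization_of_isRa hX W q hq
  refine ⟨Φ, hΦ, fun s hs x hx hmem hdim => ?_⟩
  let := X.presheaf.algebra_section_stalk ⟨x, hx⟩
  have hloc : IsLocalization.AtPrime (X.presheaf.stalk x) (W.2.primeIdealOf ⟨x, hx⟩).asIdeal :=
    W.2.isLocalization_stalk ⟨x, hx⟩
  have hsum : ∑ j, b.repr s j • θ (b j) = φ (dehom s.1 m) := by
    conv_rhs => rw [← hθ, ← b.sum_repr s, map_sum]
    simp only [map_smul]
  have H1 := H (b.repr s) hs (W.2.primeIdealOf ⟨x, hx⟩).asIdeal (X.presheaf.stalk x)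
  rw [hsum] at H1
  refine H1 ?_ hdim
  exact (IsLocalization.AtPrime.to_map_mem_maximal_iff (X.presheaf.stalk x)
    (W.2.primeIdealOf ⟨x, hx⟩).asIdeal _).mp hmem

end LocalBertini

/-! ### Codimension and closure -/

section Noetherian

open MvPolynomial TopologicalSpace

instance isNoetherian_PP (n : ℕ) (k : Type u) [Field k] : IsNoetherian (PP n k) :=
  (isNoetherian_iff_of_finite_iSup_eq_top (S := chart k) iSup_chart).mpr fun i =>
    isNoetherianRing_of_surjective _ _ (dehomHom k i) (dehomHom_surjective i)

/-- `Z` has finitely many irreducible components, so the closure of its image is the union of the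
closures of the images of their generic points. -/
lemma exists_specializes_of_mem_closure_range {Z X : Scheme.{u}} [NoetherianSpace Z] (j : Z ⟶ X)
    {x : X} (hx : x ∈ closure (Set.range j)) : ∃ z : Z, j z ⤳ x := by
  have hfin := NoetherianSpace.finite_irreducibleComponents (α := Z)
  have hU : (Set.range j : Set X) = ⋃ C ∈ irreducibleComponents Z, j '' C := by
    rw [← Set.image_univ, ← sUnion_irreducibleComponents, Set.sUnion_eq_biUnion,
      Set.image_iUnion₂]
  rw [hU, hfin.closure_biUnion] at hx
  simp only [Set.mem_iUnion] at hx
  obtain ⟨C, hC, hx⟩ := hx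
  refine ⟨hC.1.genericPoint, specializes_iff_mem_closure.mpr (closure_minimal ?_ isClosed_closure hx)⟩
  rintro _ ⟨z, hz, rfl⟩
  rw [← specializes_iff_mem_closure]
  refine Specializes.map ?_ j.continuous
  rw [specializes_iff_mem_closure,
    hC.1.closure_genericPoint (isClosed_of_mem_irreducibleComponents C hC)]
  exact hz

lemma exists_coheight_eq_zero (X : Scheme.{u}) [Nonempty X] : ∃ x : X, Order.coheight x = 0 := by
  obtain ⟨x⟩ := ‹Nonempty X›
  have hC := irreducibleComponent_mem_irreducibleComponents x
  refine ⟨hC.1.genericPoint, Order.coheight_eq_zero.mpr fun y hy => ?_⟩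
  have hg := hC.1.closure_genericPoint (isClosed_of_mem_irreducibleComponents _ hC)
  rw [Scheme.le_iff_specializes, specializes_iff_closure_subset] at hy ⊢
  rw [hg] at hy ⊢
  exact hC.2 isIrreducible_singleton.closure hy

/-- A subscheme of codimension greater than `a` does not acquire points of smaller
codimension in its closure. -/
lemma lt_coheight_of_mem_support_ker {Z X Y : Scheme.{u}} [IsNoetherian Y] (f : X ⟶ Y)
    [IsImmersion f] (j : Z ⟶ X) [IsImmersion j] {a : ℕ∞} (hZ : a < codim j) {x : X}
    (hx : f x ∈ (j ≫ f).ker.support) : a < Order.coheight x := by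
  have : NoetherianSpace Z := (j ≫ f).isEmbedding.isInducing.noetherianSpace
  have h1 : f x ∈ closure (Set.range (j ≫ f)) := by
    rw [← Scheme.Hom.support_ker]; exact hx
  have h2 : x ∈ closure (Set.range j) := by
    rw [f.isEmbedding.isInducing.closure_eq_preimage_closure_image, ← Set.range_comp]
    exact h1
  obtain ⟨z, hz⟩ := exists_specializes_of_mem_closure_range j h2
  exact hZ.trans_le ((iInf_le _ z).trans (Order.coheight_anti (Scheme.le_iff_specializes.mpr hz)))

/-- Needed for the linear system to be nonempty. A generic point of a component of `X` has
codimension `0`, too small to lie in the closure; if `X` is empty, any point will do. -/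
lemma exists_notMem_support_ker {n : ℕ} {k : Type u} [Field k] {Z X : Scheme.{u}} (f : X ⟶ PP n k)
    [IsImmersion f] (j : Z ⟶ X) [IsImmersion j] (hZ : 0 < codim j) :
    ∃ x : PP n k, x ∉ (j ≫ f).ker.support := by
  rcases isEmpty_or_nonempty X with hX | hX
  · have : IsEmpty Z := Function.isEmpty j
    refine ⟨rationalPoint 1 one_ne_zero, ?_⟩
    rw [Scheme.ker_eq_top_of_isEmpty, Scheme.IdealSheafData.support_top]
    exact id
  · obtain ⟨x, hx⟩ := exists_coheight_eq_zero X
    exact ⟨f x, fun h => (lt_coheight_of_mem_support_ker f j hZ h).ne' hx⟩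

end Noetherian

/-! ### From general vectors to an open set of lines -/

section OpenSubset

open MvPolynomial

lemma eval_smul_of_isHomogeneous {σ R : Type*} [CommSemiring R] {F : MvPolynomial σ R} {d : ℕ}
    (hF : F.IsHomogeneous d) (c : R) (v : σ → R) :
    MvPolynomial.eval (c • v) F = c ^ d * MvPolynomial.eval v F := by
  rw [MvPolynomial.eval_eq, MvPolynomial.eval_eq, Finset.mul_sum]
  refine Finset.sum_congr rfl fun α hα => ?_
  have h1 := hF (MvPolynomial.mem_support_iff.mp hα)
  have h2 : ∑ i ∈ α.support, α i = d := by
    rw [← h1, Finsupp.weight_apply, Finsupp.sum]; simp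
  simp only [Pi.smul_apply, smul_eq_mul, mul_pow, Finset.prod_mul_distrib]
  rw [Finset.prod_pow_eq_pow_sum, h2]
  ring

/-- `Φ(c v)` is a polynomial in `c` whose coefficient of `c ^ e` is the given nonzero value, so it
has a non-root in an infinite field. -/
lemma exists_eval_smul_ne_zero {σ k : Type*} [Field k] [Infinite k] (Φ : MvPolynomial σ k) (e : ℕ)
    (v : σ → k) (hv : MvPolynomial.eval v (homogeneousComponent e Φ) ≠ 0) :
    ∃ c : k, c ≠ 0 ∧ MvPolynomial.eval (c • v) Φ ≠ 0 := by
  let q : Polynomial k := ∑ i ∈ Finset.range (Φ.totalDegree + 1),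
    Polynomial.C (MvPolynomial.eval v (homogeneousComponent i Φ)) * Polynomial.X ^ i
  have hq (c : k) : q.eval c = MvPolynomial.eval (c • v) Φ := by
    conv_rhs => rw [← sum_homogeneousComponent Φ, map_sum]
    rw [Polynomial.eval_finsetSum]
    refine Finset.sum_congr rfl fun i _ => ?_
    rw [eval_smul_of_isHomogeneous (homogeneousComponent_isHomogeneous i Φ),
      Polynomial.eval_mul, Polynomial.eval_C, Polynomial.eval_pow, Polynomial.eval_X, mul_comm]
  -- The extra factor forces the non-root `c` to be nonzero.
  have hq0 : q * Polynomial.X ≠ 0 := by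
    refine mul_ne_zero (fun h => hv ?_) Polynomial.X_ne_zero
    have h1 := congr(Polynomial.coeff $h e)
    rw [Polynomial.finsetSum_coeff] at h1
    simp only [Polynomial.coeff_C_mul, Polynomial.coeff_X_pow, mul_ite, mul_one, mul_zero,
      Finset.sum_ite_eq, Finset.mem_range, Polynomial.coeff_zero] at h1
    by_cases he : e < Φ.totalDegree + 1
    · simpa [he] using h1
    · rw [homogeneousComponent_eq_zero _ _ (by omega), map_zero]
  obtain ⟨c, hc⟩ : ∃ c, (q * Polynomial.X).eval c ≠ 0 := by
    by_contra! h
    exact hq0 (Polynomial.funext fun c => by rw [h c, Polynomial.eval_zero])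
  rw [Polynomial.eval_mul, Polynomial.eval_X, hq] at hc
  exact ⟨c, right_ne_zero_of_mul hc, left_ne_zero_of_mul hc⟩

/-- `Φ` need not be homogeneous, so the open set is defined by one nonzero homogeneous component; a
representative of the line with `Φ ≠ 0` is then found by rescaling, under which `P` is invariant. -/
lemma exists_open_of_general {k : Type u} [Field k] [Infinite k] {n : ℕ}
    (I : (PP n k).IdealSheafData) (d : ℕ) (hV : ∃ s : globalSections I d, s ≠ 0)
    {Φ : MvPolynomial (Fin (Module.finrank k (globalSections I d))) k} (hΦ : Φ ≠ 0)
    {P : globalSections I d → Prop}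
    (hP : ∀ s, MvPolynomial.eval ((Module.finBasis k (globalSections I d)).repr s) Φ ≠ 0 → P s)
    (hsmul : ∀ (c : k) s, c ≠ 0 → P (c • s) → P s) :
    ∃ U : (linearSystem I d).Opens, (U : Set (linearSystem I d)).Nonempty ∧
      ∀ (s : globalSections I d) (hs : s ≠ 0), linearSystemPoint s hs ∈ U → P s := by
  obtain ⟨e, he⟩ : ∃ e, homogeneousComponent e Φ ≠ 0 := by
    by_contra! h
    exact hΦ (by rw [← sum_homogeneousComponent Φ]; exact Finset.sum_eq_zero fun i _ => h i)
  have hmem {c} (hc : c ≠ 0) : rationalPoint c hc ∈ Proj.basicOpen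
      (homogeneousSubmodule (Fin (Module.finrank k (globalSections I d))) k)
        (homogeneousComponent e Φ) ↔
      MvPolynomial.eval c (homogeneousComponent e Φ) ≠ 0 := by
    rw [Proj.mem_basicOpen]
    exact (mem_rationalPoint_iff c hc e _ (homogeneousComponent_isHomogeneous e Φ)).not
  refine ⟨Proj.basicOpen _ (homogeneousComponent e Φ), ?_, fun s hs hsU => ?_⟩
  · obtain ⟨s, hs⟩ := hV
    have : Nontrivial (globalSections I d) := ⟨s, 0, hs⟩
    have hpos : 0 < Module.finrank k (globalSections I d) :=
      Module.finrank_pos (R := k) (M := globalSections I d)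
    let j : Fin (Module.finrank k (globalSections I d)) := ⟨0, hpos⟩
    -- The factor `X j` guarantees `v ≠ 0`, which matters when the chosen component is constant.
    obtain ⟨v, hv⟩ : ∃ v, MvPolynomial.eval v (homogeneousComponent e Φ * X j) ≠ 0 := by
      by_contra! h
      exact mul_ne_zero he (X_ne_zero j) (MvPolynomial.funext fun v => by rw [h v, map_zero])
    rw [map_mul, eval_X] at hv
    have hv0 : v ≠ 0 := fun h => right_ne_zero_of_mul hv (by rw [h]; rfl)
    exact ⟨rationalPoint v hv0, (hmem hv0).mpr (left_ne_zero_of_mul hv)⟩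
  · obtain ⟨c, hc, hcΦ⟩ := exists_eval_smul_ne_zero Φ e _ ((hmem _).mp hsU)
    refine hsmul c s hc (hP _ ?_)
    rwa [map_smul, Finsupp.coe_smul]

end OpenSubset

/-! ### Assembly over a finite affine cover -/

section Main

open MvPolynomial IsLocalRing

variable {k : Type u} [Field k] {n : ℕ}

lemma exists_affine_isUnit_appLE {X : Scheme.{u}} (f : X ⟶ PP n k)
    (I : (PP n k).IdealSheafData) (x : X) (hx : f x ∉ I.support) :
    ∃ (m : Fin (n + 1)) (e : ℕ) (g : homogeneousSubmodule (Fin (n + 1)) k e) (W : X.affineOpens)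
      (hW : W.1 ≤ f ⁻¹ᵁ (chart k m).1), g ∈ globalSections I e ∧ x ∈ W.1 ∧
      IsUnit ((f.appLE (chart k m).1 W.1 hW).hom (dehom g m)) := by
  obtain ⟨m, e, g, hg, hxg⟩ := exists_globalSections_mem_basicOpen I (f x) hx
  obtain ⟨W, hW, hxW, hWU⟩ := exists_isAffineOpen_mem_and_subset
    (U := f ⁻¹ᵁ (PP n k).basicOpen (dehom g m)) hxg
  have hWU' : W ≤ f ⁻¹ᵁ (PP n k).basicOpen (dehom g m) := hWU
  refine ⟨m, e, g, ⟨W, hW⟩, fun y hy => (PP n k).basicOpen_le _ (hWU hy), hg, hxW, ?_⟩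
  have h1 := f.map_appLE hWU' (homOfLE ((PP n k).basicOpen_le (dehom g m))).op
  rw [← h1]
  exact ((PP n k).toRingedSpace.isUnit_res_basicOpen (dehom g m)).map (f.appLE _ W hWU').hom

lemma hypersurfaceIdeal_smul {d : ℕ} (s : homogeneousSubmodule (Fin (n + 1)) k d) {c : k}
    (hc : c ≠ 0) : hypersurfaceIdeal (c • s) = hypersurfaceIdeal s := by
  unfold hypersurfaceIdeal
  congr 1
  ext J
  exact (globalSections J d).smul_mem_iff hc

lemma interHypersurface_smul {X : Scheme.{u}} (f : X ⟶ PP n k) {d : ℕ}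
    (s : homogeneousSubmodule (Fin (n + 1)) k d) {c : k} (hc : c ≠ 0) :
    interHypersurface f (c • s) = interHypersurface f s :=
  congrArg (fun J : (PP n k).IdealSheafData => pullback f J.subschemeι)
    (hypersurfaceIdeal_smul s hc)

theorem generalHypersurface_isRa [Infinite k] {a : ℕ} {X Z : Scheme.{u}} (i : X ⟶ PP n k)
    [IsImmersion i] (j : Z ⟶ X) [IsImmersion j] (hX : IsRa a X) (hZ : (a : ℕ∞) + 1 < codim j) :
    GeneralHypersurface (j ≫ i).ker i (IsRa a) := by
  let I := (j ≫ i).ker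
  have : TopologicalSpace.NoetherianSpace X := i.isEmbedding.isInducing.noetherianSpace
  have : IsLocallyNoetherian X := LocallyOfFiniteType.isLocallyNoetherian i
  let S : Set X := {x | i x ∉ I.support}
  choose m e g W hW hg hxW hu using fun x : S => exists_affine_isUnit_appLE i I x.1 x.2
  obtain ⟨T, hT⟩ := (TopologicalSpace.NoetherianSpace.isCompact S).elim_finite_subcover
    (fun x : S => ((W x).1 : Set X)) (fun x => (W x).1.isOpen)
    (fun x hx => Set.mem_iUnion.mpr ⟨⟨x, hx⟩, hxW _⟩)
  obtain ⟨p, hp⟩ := exists_notMem_support_ker i j (zero_le.trans_lt hZ)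
  obtain ⟨m₀, e₀, g₀, hg₀, hpg₀⟩ := exists_globalSections_mem_basicOpen I p hp
  -- The summand `e₀` ensures a nonzero section of degree `d`; the supremum ensures `e x < d` on
  -- every piece of the cover.
  refine ⟨e₀ + T.sup fun x => e x + 1, fun d hd => ?_⟩
  have hed (x : S) (hx : x ∈ T) : e x < d := by
    have := Finset.le_sup (f := fun x => e x + 1) hx
    omega
  have hV : ∃ s : globalSections I d, s ≠ 0 := by
    have hhom : (g₀.1 * MvPolynomial.X m₀ ^ (d - e₀)).IsHomogeneous d := by
      have := MvPolynomial.IsHomogeneous.mul g₀.2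
        ((MvPolynomial.isHomogeneous_X k m₀).pow (d - e₀))
      convert this using 1
      omega
    refine ⟨⟨⟨_, hhom⟩, mem_globalSections_of_eq_mul hg₀ rfl⟩, fun h => ?_⟩
    have h1 : g₀.1 * MvPolynomial.X m₀ ^ (d - e₀) = 0 := congr(($h).1.1)
    have h2 : g₀ = 0 := Subtype.ext
      ((mul_eq_zero.mp h1).resolve_right (pow_ne_zero _ (MvPolynomial.X_ne_zero m₀)))
    rw [h2, dehom_zero, Scheme.basicOpen_zero] at hpg₀
    exact hpg₀
  let b := Module.finBasis k (globalSections I d)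
  have hloc (x : S) (hx : e x < d) := exists_general_isRegularLocalRing_stalk_quotient i hX I (m x)
    (W x) (hW x) (hg x) (hu x) hx b
  choose Φ hΦ H using hloc
  refine exists_open_of_general I d hV (Φ := ∏ x ∈ T.attach, Φ x.1 (hed x.1 x.2))
    (Finset.prod_ne_zero_iff.mpr fun x _ => hΦ _ _) (fun s hs y hy => ?_) fun c s hc h => ?_
  · rw [map_prod, Finset.prod_ne_zero_iff] at hs
    obtain ⟨x, hx⟩ := exists_stalk_interHypersurface_equiv s.1 i y
    by_cases hxS : i x ∈ I.support
    -- On the closure of `Z` the codimension in `X` exceeds `a + 1`, while one equation lowers the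
    -- dimension by at most one.
    · exfalso
      obtain ⟨m', hm'⟩ := exists_mem_chart (i x)
      obtain ⟨W', hW', hxW', hWU'⟩ := exists_isAffineOpen_mem_and_subset
        (U := i ⁻¹ᵁ (chart k m').1) hm'
      obtain ⟨hmax, ⟨E⟩⟩ := hx m' ⟨W', hW'⟩ hWU' hxW'
      have h1 := ringKrullDim_le_ringKrullDim_quotient_span_singleton_add_one hmax
      rw [ringKrullDim_eq_of_ringEquiv E, ringKrullDim_stalk_eq_coheight] at h1
      have h2 := lt_coheight_of_mem_support_ker i j hZ hxS
      have h3 : ((Order.coheight x : ℕ∞) : WithBot ℕ∞) ≤ ((a + 1 : ℕ∞) : WithBot ℕ∞) :=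
        h1.trans (add_le_add_left hy 1)
      exact absurd (WithBot.coe_le_coe.mp h3) h2.not_ge
    · obtain ⟨t, ht, hxt⟩ := Set.mem_iUnion₂.mp (hT hxS)
      obtain ⟨hmax, ⟨E⟩⟩ := hx (m t) (W t) (hW t) hxt
      have := H t (hed t ht) s (hs ⟨t, ht⟩ (Finset.mem_attach _ _)) x hxt hmax
        ((ringKrullDim_eq_of_ringEquiv E).trans_le hy)
      exact IsRegularLocalRing.of_ringEquiv E
  · rwa [Submodule.coe_smul, interHypersurface_smul _ _ hc] at h

end Main

end RaBertini

end

/-- `i : X ⟶ ℙⁿ_k` and `j : Z ⟶ X` are the given subschemes; `(j ≫ i).ker` is the ideal sheaf of the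
scheme-theoretic closure of `Z` in `ℙⁿ_k`. -/
theorem mainTheorem6 {k : Type u} [Field k] [Infinite k] (n a : ℕ) {X Z : Scheme.{u}}
    (i : X ⟶ RaBertini.PP n k) [IsImmersion i] (j : Z ⟶ X) [IsImmersion j]
    (hX : RaBertini.IsRa a X) (hZ : (a : ℕ∞) + 1 < RaBertini.codim j) :
    RaBertini.GeneralHypersurface (j ≫ i).ker i (RaBertini.IsRa a) := by
  exact RaBertini.generalHypersurface_isRa i j hX hZ
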